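/- Consider the regular hexagonal tiling of the plane; two distinct cells are adjacent when they share an edge. A Rikudo game $(\tau,m,p)$ consists of a nonempty finite set $\tau$ of cells whose adjacency graph $G_\tau$ is connected and, with $n=|\tau|$ and $[n]=\{1,\dots,n\}$, a partial injective map $m$ from $\tau$ to $[n]$ (numbers already placed) and a set $p$ of ordered pairs of adjacent cells of $\tau$ (given adjacencies). A solution is a bijection $s:\tau\to[n]$ such that (i) any two cells $c,c'\in\tau$ with $|s(c)-s(c')|=1$ are adjacent, (ii) $s(c)=m(c)$ for every $c$ in the domain of $m$, and (iii) $|s(c)-s(c')|=1$ for every $(c,c')\in p$. The decision problem 1-over-2-Rikudo takes as input a game $(\tau,m,p)$ in which the set of values of $m$ (the numbers already placed) is exactly the set of odd numbers in $[n]$, and asks whether the game admits a solution. A game is given as a word over a fixed finite alphabet that lists the elements of $\tau$, the graph of $m$ and the elements of $p$, with cells given by integer axial coordinates and all integers written in binary. Theorem. 1-over-2-Rikudo is in $\mathsf{P}$: the language of the words that describe such a game admitting a solution is decided by a deterministic Turing machine in time polynomial in the length of the word. -/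

import Mathlib

namespace Rikudo

/-- Cells of the hexagonal grid (pointy orientation) in axial coordinates. -/
abbrev Cell := ℤ × ℤ

/-- The adjacency graph of the hexagonal grid: two cells are adjacent when they share an edge.
In axial coordinates, the six neighbours of `(a, b)` are `(a ± 1, b)`, `(a, b ± 1)`,
`(a + 1, b - 1)` and `(a - 1, b + 1)`. -/
def hexGrid : SimpleGraph Cell where
  Adj c c' :=
    (c'.1 - c.1, c'.2 - c.2) ∈
      ({(1, 0), (-1, 0), (0, 1), (0, -1), (1, -1), (-1, 1)} : Set (ℤ × ℤ))
  symm := ⟨fun c c' h => by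
    simp only [Set.mem_insert_iff, Set.mem_singleton_iff, Prod.mk.injEq] at h ⊢
    omega⟩
  loopless := ⟨fun c h => by
    simp at h⟩

/-- A Rikudo game `(τ, m, p)`. The partial map `m` is given as an `Option`-valued function that is
`none` outside `τ`; `p` is a set of ordered pairs, not necessarily symmetric. -/
structure Game where
  /-- the cells of the game -/
  τ : Finset Cell
  /-- the graph `G_τ` is connected (in particular, nonempty) -/
  connected : (hexGrid.induce (τ : Set Cell)).Connected
  /-- the numbers already placed -/
  m : Cell → Option ℕ
  m_dom : ∀ c v, m c = some v → c ∈ τ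
  m_range : ∀ c v, m c = some v → 1 ≤ v ∧ v ≤ τ.card
  m_inj : ∀ c c' v, m c = some v → m c' = some v → c = c'
  /-- the given adjacencies -/
  p : Finset (Cell × Cell)
  p_adj : ∀ c c', (c, c') ∈ p → c ∈ τ ∧ c' ∈ τ ∧ hexGrid.Adj c c'

namespace Game

/-- The number `n` of cells. -/
def n (G : Game) : ℕ := G.τ.card

/-- `s` (only its values on `τ` matter) is a solution of the game `G`. -/
structure IsSolution (G : Game) (s : Cell → ℕ) : Prop where
  bij : Set.BijOn s (G.τ : Set Cell) (Set.Icc 1 G.n)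
  path : ∀ c ∈ G.τ, ∀ c' ∈ G.τ, |(s c : ℤ) - (s c' : ℤ)| = 1 → hexGrid.Adj c c'
  placed : ∀ c v, G.m c = some v → s c = v
  given : ∀ c c', (c, c') ∈ G.p → |(s c : ℤ) - (s c' : ℤ)| = 1

/-- The game admits a solution. -/
def Solvable (G : Game) : Prop := ∃ s, G.IsSolution s

/-- The numbers already placed are exactly those of the form `x * k + 1` in `{1, …, n}`. -/
def IsOneOver (k : ℕ) (G : Game) : Prop :=
  {v | ∃ c, G.m c = some v} = {v | ∃ x : ℕ, v = x * k + 1} ∩ Set.Icc 1 G.n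

end Game

section Encoding

open Computability

/-- Binary digits of a natural number, least significant first (`0` gives the empty word). -/
def encNat (v : ℕ) : List Γ' := (encodeNat v).map Γ'.bit

/-- An integer: a sign bit, then the binary digits of the absolute value. -/
def encInt (z : ℤ) : List Γ' := Γ'.bit (decide (z < 0)) :: encNat z.natAbs

/-- A cell: its two coordinates, separated by a comma. -/
def encCell (c : Cell) : List Γ' := encInt c.1 ++ Γ'.comma :: encInt c.2

/-- A list: the concatenation of its bracketed entries. -/
def encList {α : Type} (e : α → List Γ') (l : List α) : List Γ' :=
  l.flatMap fun a => Γ'.bra :: e a ++ [Γ'.ket]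

/-- The word for a list of cells, a list of placed numbers and a list of adjacencies. -/
def encLists (cells : List Cell) (placed : List (Cell × ℕ)) (links : List (Cell × Cell)) :
    List Γ' :=
  encList encCell cells ++
    Γ'.comma :: encList (fun e => encCell e.1 ++ Γ'.comma :: encNat e.2) placed ++
    Γ'.comma :: encList (fun e => encCell e.1 ++ Γ'.comma :: encCell e.2) links

/-- The word `w` describes the game `G`: it lists `τ`, the graph of `m` and `p`, each in some
order and without repetition, all integers being written in binary. -/
def Encodes (w : List Γ') (G : Game) : Prop :=
  ∃ (cells : List Cell) (placed : List (Cell × ℕ)) (links : List (Cell × Cell)),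
    cells.Nodup ∧ placed.Nodup ∧ links.Nodup ∧
    (∀ c, c ∈ cells ↔ c ∈ G.τ) ∧
    (∀ c v, (c, v) ∈ placed ↔ G.m c = some v) ∧
    (∀ e, e ∈ links ↔ e ∈ G.p) ∧
    w = encLists cells placed links

/-- The decision problem 1-over-`k`-Rikudo, as the language of the words that describe a
1-over-`k` game admitting a solution. -/
def oneOverRikudo (k : ℕ) : Language Γ' :=
  {w | ∃ G : Game, Encodes w G ∧ G.IsOneOver k ∧ G.Solvable}

end Encoding

/-- The complexity class `P`: the language `L` is decided, on all words over `Γ`, by a Turing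
machine (with finitely many symbols on every stack) in a number of steps that is bounded by a
polynomial in the length of the word. -/
def InP {Γ : Type} (L : Language Γ) : Prop :=
  ∃ (f : List Γ → Bool)
    (M : Turing.TM2ComputableInPolyTime (id : List Γ → List Γ) Computability.encodeBool f),
    (∀ k, Finite (M.tm.Γ k)) ∧ ∀ w, f w = true ↔ w ∈ L

end Rikudo

open Computability

namespace Rikudo

/-! ### Machine fragments on four stacks -/

/-! In a solution the number 2i+2 lies on a free cell adjacent to the cells of 2i+1 and, if it
exists, of 2i+3. Those two cells are known and distinct, and two distinct hexagons have at most two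
common neighbours (`length_common_neighbors_le`). So every even number has at most two candidate
cells, except possibly n itself when n is even: it has a single odd neighbour, which leaves up to
six. A given adjacency joins numbers of opposite parity. Between two placed cells it is fatal; at a
free cell it only asks that the other end carry 2i+1 or 2i+3, so it is absorbed in `candidates`.
What remains is a choice of distinct representatives from lists that, apart from the last one, have
at most two entries (`exists_representatives_of_solves`, `exists_solves_of_representatives`).

With cells as vertices and short lists as edges, such a choice fails when a component has more edges
than vertices, and this is detected greedily. Keep disjoint blocks of cells such that the lists
treated so far can use all cells of a block but one, the spare cell being arbitrary. A list meeting
two blocks merges them, a list meeting one block consumes it, and a list meeting none means failure.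
The precise statement is `matchable_cons`. The last list only has to meet some block, so its length
does not matter (`foldl_matchStep`).

Connectedness needs no test, because a solution is a Hamiltonian path (`Solves.connected`). Syntax
is tested by encoding the parsed data again and comparing with the input (`decideWord_iff`).

On the machine side all data are binary trees, written as prefix words on a stack. A `PolyTime`
function has a flow graph that replaces the top tree and restores everything else, so such functions
compose. They are closed under pairing, case distinction and folds whose intermediate values stay of
polynomial size (`PolyTime.foldl`), which suffices to build the whole algorithm. `PolyTime.inP`
turns the result into a Turing machine. -/

/-- Names of the four work stacks. -/
inductive Reg
  | m | a | b | c
  deriving DecidableEq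

instance : Fintype Reg := ⟨{.m, .a, .b, .c}, fun x => by cases x <;> simp⟩

/-- The contents of the four work stacks. -/
structure Store where
  /-- the main stack -/
  m : List Γ'
  /-- the first auxiliary stack -/
  a : List Γ'
  /-- the second auxiliary stack -/
  b : List Γ'
  /-- the counter stack -/
  c : List Γ'

/-- The contents of one stack. -/
def Store.get (S : Store) : Reg → List Γ'
  | .m => S.m
  | .a => S.a
  | .b => S.b
  | .c => S.c

/-- Replace the contents of one stack. -/
def Store.set (S : Store) (l : List Γ') : Reg → Store
  | .m => { S with m := l }
  | .a => { S with a := l }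
  | .b => { S with b := l }
  | .c => { S with c := l }

/-- An instruction, with jump targets in `X`. -/
inductive Instr (X : Type)
  | push (k : Reg) (s : Γ') (x : X)
  | pop (k : Reg) (f : Option Γ' → X)
  | jump (x : X)

namespace Instr

/-- Rename the jump targets. -/
def map {X Y : Type} (φ : X → Y) : Instr X → Instr Y
  | push k s x => push k s (φ x)
  | pop k f => pop k fun o => φ (f o)
  | jump x => jump (φ x)

/-- Execute an instruction. -/
def exec {X : Type} : Instr X → Store → X × Store
  | push k s x, S => (x, S.set (s :: S.get k) k)
  | pop k f, S => (f (S.get k).head?, S.set (S.get k).tail k)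
  | jump x, S => (x, S)

theorem exec_map {X Y : Type} (φ : X → Y) (i : Instr X) (S : Store) :
    (i.map φ).exec S = (φ (i.exec S).1, (i.exec S).2) := by
  cases i <;> rfl

end Instr

/-- A finite flow graph with exits in `E`. -/
structure Frag (E : Type) where
  /-- the labels -/
  L : Type
  /-- there are finitely many labels -/
  fin : Fintype L
  /-- the entry label -/
  start : L
  /-- the program -/
  code : L → Instr (L ⊕ E)

namespace Frag

variable {E E' : Type}

/-- `Steps F t x y`: the fragment leads from the configuration `x` to `y` in `t` steps. -/
inductive Steps (F : Frag E) : ℕ → (F.L ⊕ E) × Store → (F.L ⊕ E) × Store → Prop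
  | refl (x) : Steps F 0 x x
  | step {l S t y} : Steps F t ((F.code l).exec S) y → Steps F (t + 1) (.inl l, S) y

theorem Steps.trans {F : Frag E} {t t' : ℕ} {x y z} (h : F.Steps t x y) (h' : F.Steps t' y z) :
    F.Steps (t + t') x z := by
  induction h with
  | refl => simpa using h'
  | step _ ih => rw [Nat.add_right_comm]; exact .step (ih h')

/-- Relabelling jump targets is a simulation. This one fact embeds fragments both in `bind` and in
`loop`. -/
theorem Steps.map {F : Frag E} {H : Frag E'} (φ : F.L ⊕ E → H.L ⊕ E') (j : F.L → H.L)
    (hj : ∀ l, φ (.inl l) = .inl (j l)) (hc : ∀ l, H.code (j l) = (F.code l).map φ)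
    {t : ℕ} {x y} (h : F.Steps t x y) : H.Steps t (φ x.1, x.2) (φ y.1, y.2) := by
  induction h with
  | refl => exact .refl _
  | step _ ih => rw [hj]; refine .step ?_; rwa [hc, Instr.exec_map]

/-- `F.Run S T e S'`: started on `S`, the fragment leaves through the exit `e` with stacks `S'`
after at most `T` steps. -/
def Run (F : Frag E) (S : Store) (T : ℕ) (e : E) (S' : Store) : Prop :=
  ∃ t ≤ T, F.Steps t (.inl F.start, S) (.inr e, S')

theorem Run.mono {F : Frag E} {S S' : Store} {T T' : ℕ} {e : E} (h : F.Run S T e S')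
    (hT : T ≤ T') : F.Run S T' e S' :=
  let ⟨t, ht, h⟩ := h; ⟨t, ht.trans hT, h⟩

/-- A single instruction. -/
def single (i : Instr E) : Frag E where
  L := Unit
  fin := inferInstance
  start := ()
  code _ := i.map .inr

theorem run_single (i : Instr E) (S : Store) :
    (single i).Run S 1 (i.exec S).1 (i.exec S).2 := by
  refine ⟨1, le_rfl, .step ?_⟩
  rw [show ((single i).code (single i).start) = i.map .inr from rfl, Instr.exec_map]
  exact .refl _

/-- Push a symbol. -/
def push (k : Reg) (s : Γ') : Frag Unit := single (.push k s ())

/-- Pop a symbol and exit through it. -/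
def pop (k : Reg) : Frag (Option Γ') := single (.pop k id)

/-- Do nothing. -/
def ret (e : E) : Frag E := single (.jump e)

theorem run_push (k : Reg) (s : Γ') (S : Store) : (push k s).Run S 1 () (S.set (s :: S.get k) k) :=
  run_single _ S

theorem run_pop (k : Reg) (S : Store) :
    (pop k).Run S 1 (S.get k).head? (S.set (S.get k).tail k) :=
  run_single _ S

theorem run_ret (e : E) (S : Store) : (ret e).Run S 1 e S :=
  run_single _ S

/-- Run `F`, then the fragment selected by its exit. -/
def bind [Fintype E] (F : Frag E) (G : E → Frag E') : Frag E' where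
  L := F.L ⊕ Σ e, (G e).L
  fin := by
    have := F.fin
    have := fun e => (G e).fin
    infer_instance
  start := .inl F.start
  code
    | .inl l => (F.code l).map (Sum.elim (fun l => .inl (.inl l))
        fun e => .inl (.inr ⟨e, (G e).start⟩))
    | .inr ⟨e, l⟩ => ((G e).code l).map (Sum.elim (fun l => .inl (.inr ⟨e, l⟩)) .inr)

theorem Run.bind [Fintype E] {F : Frag E} {G : E → Frag E'} {S S' S'' : Store} {T T' : ℕ} {e : E}
    {e' : E'} (h : F.Run S T e S') (h' : (G e).Run S' T' e' S'') :
    (F.bind G).Run S (T + T') e' S'' := by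
  obtain ⟨t, ht, h⟩ := h
  obtain ⟨t', ht', h'⟩ := h'
  refine ⟨t + t', add_le_add ht ht', ?_⟩
  have h₁ := h.map (H := F.bind G) (Sum.elim (fun l => .inl (.inl l))
        fun e => .inl (.inr ⟨e, (G e).start⟩)) .inl (fun _ => rfl) (fun _ => rfl)
  have h₂ := h'.map (H := F.bind G) (Sum.elim (fun l => .inl (.inr ⟨e, l⟩)) .inr)
    (fun l => .inr ⟨e, l⟩) (fun _ => rfl) (fun _ => rfl)
  exact h₁.trans h₂

/-- How `loop` redirects the jump targets. -/
def loopMap {F : Frag (Option E)} : F.L ⊕ Option E → F.L ⊕ E :=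
  Sum.elim .inl fun o => o.elim (.inl F.start) .inr

/-- Repeat `F` until it leaves through an exit `some e`. -/
def loop (F : Frag (Option E)) : Frag E where
  L := F.L
  fin := F.fin
  start := F.start
  code l := (F.code l).map loopMap

theorem Run.loop_exit {F : Frag (Option E)} {S S' : Store} {T : ℕ} {e : E}
    (h : F.Run S T (some e) S') : (loop F).Run S T e S' := by
  obtain ⟨t, ht, h⟩ := h
  exact ⟨t, ht, h.map (F := F) (H := F.loop) loopMap id (fun _ => rfl) (fun _ => rfl)⟩

theorem Run.loop_next {F : Frag (Option E)} {S S' S'' : Store} {T T' : ℕ} {e : E}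
    (h : F.Run S T none S') (h' : (loop F).Run S' T' e S'') :
    (loop F).Run S (T + T') e S'' := by
  obtain ⟨t, ht, h⟩ := h
  obtain ⟨t', ht', h'⟩ := h'
  have h₁ := h.map (F := F) (H := F.loop) loopMap id (fun _ => rfl) (fun _ => rfl)
  exact ⟨t + t', add_le_add ht ht', h₁.trans h'⟩

/-- Run two fragments in succession. -/
def seq (F : Frag Unit) (G : Frag E) : Frag E := F.bind fun _ => G

theorem Run.seq {F : Frag Unit} {G : Frag E} {S S' S'' : Store} {T T' : ℕ} {e : E}
    (h : F.Run S T () S') (h' : G.Run S' T' e S'') : (F.seq G).Run S (T + T') e S'' :=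
  Run.bind h h'

end Frag

/-! ### Binary trees on the main stack -/

/-- Binary trees, the universal data type. -/
inductive Tree
  | leaf
  | node (l r : Tree)

namespace Tree

/-- The prefix code of a tree. -/
def word : Tree → List Γ'
  | leaf => [.bit false]
  | node l r => .bit true :: (l.word ++ r.word)

/-- The length of the prefix code. -/
def size (v : Tree) : ℕ := v.word.length

@[simp] theorem size_leaf : leaf.size = 1 := rfl

@[simp] theorem size_node (l r : Tree) : (node l r).size = l.size + r.size + 1 := by
  simp [size, word]

theorem size_pos (v : Tree) : 0 < v.size := by
  cases v <;> simp

/-- Tree words form a prefix code, so a tree can be recognised on top of arbitrary stack contents.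
The remainders `x` and `y` are general because the left subtree is followed by the right one. -/
theorem word_prefix_injective (v : Tree) :
    ∀ (w : Tree) (x y : List Γ'), v.word ++ x = w.word ++ y → v = w ∧ x = y := by
  induction v with
  | leaf =>
    rintro (_ | _) x y h
    · simpa [word] using h
    · simp [word] at h
  | node l r ihl ihr =>
    rintro (_ | ⟨l', r'⟩) x y h
    · simp [word] at h
    · simp only [word, List.cons_append, List.append_assoc, List.cons.injEq, true_and] at h
      obtain ⟨rfl, h₁⟩ := ihl _ _ _ h
      obtain ⟨rfl, h₂⟩ := ihr _ _ _ h₁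
      exact ⟨rfl, h₂⟩

theorem word_injective : Function.Injective word := fun v w h =>
  (word_prefix_injective v w [] [] (by rw [h])).1

/-- This is what makes the comma usable as an end mark on the auxiliary stacks. -/
theorem comma_notMem_word (v : Tree) : Γ'.comma ∉ v.word := by
  induction v with
  | leaf => simp [word]
  | node l r ihl ihr => simp [word, ihl, ihr]

end Tree

namespace Frag

/-- Push a symbol on those of the stacks `a` and `b` that are selected. -/
def tee (ta tb : Bool) (s : Γ') : Frag Unit :=
  (bif ta then push .a s else ret ()).seq (bif tb then push .b s else ret ())

/-- The effect of moving the word `w` to a stack, if this stack is selected. -/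
def teeList (t : Bool) (w l : List Γ') : List Γ' := bif t then w.reverse ++ l else l

theorem teeList_cons (t : Bool) (s : Γ') (w l : List Γ') :
    teeList t (s :: w) l = teeList t w (teeList t [s] l) := by
  cases t <;> simp [teeList]

theorem teeList_append (t : Bool) (w w' l : List Γ') :
    teeList t (w ++ w') l = teeList t w' (teeList t w l) := by
  cases t <;> simp [teeList]

theorem run_tee (ta tb : Bool) (s : Γ') (m a b c : List Γ') :
    (tee ta tb s).Run ⟨m, a, b, c⟩ 2 () ⟨m, teeList ta [s] a, teeList tb [s] b, c⟩ := by
  cases ta <;> cases tb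
  · exact Run.seq (run_ret _ _) (run_ret _ _)
  · exact Run.seq (run_ret _ _) (run_push _ _ _)
  · exact Run.seq (run_push _ _ _) (run_ret _ _)
  · exact Run.seq (run_push _ _ _) (run_push _ _ _)

/-- One step of moving a tree: the stack `c` counts the subtrees that are still to come. -/
def moveStep (ta tb : Bool) : Frag (Option Unit) :=
  (pop .m).bind fun
    | some (.bit true) => (tee ta tb (.bit true)).seq ((push .c .bra).seq (ret none))
    | some (.bit false) => (tee ta tb (.bit false)).seq ((pop .c).bind fun
      | some .bra => ret none
      | _ => ret (some ()))
    | _ => ret none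

theorem run_moveStep_node (ta tb : Bool) (m a b c : List Γ') :
    (moveStep ta tb).Run ⟨.bit true :: m, a, b, c⟩ 5 none
      ⟨m, teeList ta [.bit true] a, teeList tb [.bit true] b, .bra :: c⟩ :=
  Run.mono (Run.bind (e := some (Γ'.bit true)) (run_pop _ _)
    (Run.seq (run_tee ..) (Run.seq (run_push ..) (run_ret ..)))) le_rfl

theorem run_moveStep_leaf_bra (ta tb : Bool) (m a b c : List Γ') :
    (moveStep ta tb).Run ⟨.bit false :: m, a, b, .bra :: c⟩ 5 none
      ⟨m, teeList ta [.bit false] a, teeList tb [.bit false] b, c⟩ :=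
  Run.mono (Run.bind (e := some (Γ'.bit false)) (run_pop _ _)
    (Run.seq (run_tee ..) (Run.bind (e := some Γ'.bra) (run_pop ..) (run_ret ..)))) le_rfl

theorem run_moveStep_leaf_ket (ta tb : Bool) (m a b c : List Γ') :
    (moveStep ta tb).Run ⟨.bit false :: m, a, b, .ket :: c⟩ 5 (some ())
      ⟨m, teeList ta [.bit false] a, teeList tb [.bit false] b, c⟩ :=
  Run.mono (Run.bind (e := some (Γ'.bit false)) (run_pop _ _)
    (Run.seq (run_tee ..) (Run.bind (e := some Γ'.ket) (run_pop ..) (run_ret ..)))) le_rfl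

/-- A node replaces one expected subtree by two, and a leaf settles one. A `bra` on the counter
means that another subtree is due after `v`, so the loop goes on; hence the continuation as a
hypothesis. -/
theorem run_loop_moveStep_bra (ta tb : Bool) (v : Tree) :
    ∀ (m a b c : List Γ') (T : ℕ) (S : Store),
      (loop (moveStep ta tb)).Run ⟨m, teeList ta v.word a, teeList tb v.word b, c⟩ T () S →
      (loop (moveStep ta tb)).Run ⟨v.word ++ m, a, b, .bra :: c⟩ (5 * v.size + T) () S := by
  induction v with
  | leaf =>
    intro m a b c T S h
    exact Run.loop_next (run_moveStep_leaf_bra ..) h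
  | node l r ihl ihr =>
    intro m a b c T S h
    have h₁ := ihl (r.word ++ m) (teeList ta [.bit true] a) (teeList tb [.bit true] b) (.bra :: c)
      _ _ (ihr m _ _ c T S (by
        rwa [← teeList_append, ← teeList_cons, ← teeList_append, ← teeList_cons]))
    rw [← List.append_assoc] at h₁
    exact Run.mono (Run.loop_next (run_moveStep_node ..) h₁) (by rw [Tree.size_node]; omega)

/-- The `ket` at the bottom stops the loop at the last leaf of `v`. In a node, the left subtree runs
under a fresh `bra`, while the right one inherits the `ket`. -/
theorem run_loop_moveStep_ket (ta tb : Bool) (v : Tree) :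
    ∀ m a b c : List Γ',
      (loop (moveStep ta tb)).Run ⟨v.word ++ m, a, b, .ket :: c⟩ (5 * v.size) ()
        ⟨m, teeList ta v.word a, teeList tb v.word b, c⟩ := by
  induction v with
  | leaf =>
    intro m a b c
    exact Run.loop_exit (run_moveStep_leaf_ket ..)
  | node l r _ ihr =>
    intro m a b c
    have h₁ := run_loop_moveStep_bra ta tb l (r.word ++ m) (teeList ta [.bit true] a)
      (teeList tb [.bit true] b) (.ket :: c) _ _ (ihr m _ _ c)
    rw [← teeList_append, ← teeList_cons, ← teeList_append, ← teeList_cons] at h₁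
    rw [← List.append_assoc] at h₁
    exact Run.mono (Run.loop_next (run_moveStep_node ..) h₁) (by rw [Tree.size_node]; omega)

/-- Move the tree on top of the stack `m` to the selected stacks, reversing its word. -/
def move (ta tb : Bool) : Frag Unit :=
  (tee ta tb .comma).seq ((push .c .ket).seq (loop (moveStep ta tb)))

theorem run_move (ta tb : Bool) (v : Tree) (m a b c : List Γ') :
    (move ta tb).Run ⟨v.word ++ m, a, b, c⟩ (5 * v.size + 3) ()
      ⟨m, teeList ta (.comma :: v.word) a, teeList tb (.comma :: v.word) b, c⟩ := by
  rw [teeList_cons ta, teeList_cons tb]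
  exact Run.mono (Run.seq (run_tee ..) (Run.seq (run_push ..) (run_loop_moveStep_ket ta tb v ..)))
    (by omega)

/-- Move the symbols of an auxiliary stack down to the next mark back to the stack `m`. -/
def back (k : Reg) : Frag Unit :=
  loop ((pop k).bind fun
    | some .comma => ret (some ())
    | some s => (push .m s).seq (ret none)
    | none => ret (some ()))

theorem run_back_a (w : List Γ') (hw : Γ'.comma ∉ w) : ∀ m a b c : List Γ',
    (back .a).Run ⟨m, w ++ .comma :: a, b, c⟩ (3 * w.length + 2) () ⟨w.reverse ++ m, a, b, c⟩ := by
  induction w with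
  | nil =>
    intro m a b c
    exact Run.mono (Run.loop_exit (Run.bind (e := some Γ'.comma) (run_pop ..) (run_ret ..))) le_rfl
  | cons s w ih =>
    intro m a b c
    simp only [List.mem_cons, not_or] at hw
    have h := ih hw.2 (s :: m) a b c
    rw [List.reverse_cons, List.append_assoc, List.length_cons]
    refine Run.mono (Run.loop_next (Run.bind (e := some s) (run_pop ..) (T' := 2) ?_) h) (by omega)
    rcases s with _ | _ | _ | _ | _
    any_goals exact Run.seq (run_push ..) (run_ret ..)
    exact absurd rfl hw.1

theorem run_back_b (w : List Γ') (hw : Γ'.comma ∉ w) : ∀ m a b c : List Γ',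
    (back .b).Run ⟨m, a, w ++ .comma :: b, c⟩ (3 * w.length + 2) () ⟨w.reverse ++ m, a, b, c⟩ := by
  induction w with
  | nil =>
    intro m a b c
    exact Run.mono (Run.loop_exit (Run.bind (e := some Γ'.comma) (run_pop ..) (run_ret ..))) le_rfl
  | cons s w ih =>
    intro m a b c
    simp only [List.mem_cons, not_or] at hw
    have h := ih hw.2 (s :: m) a b c
    rw [List.reverse_cons, List.append_assoc, List.length_cons]
    refine Run.mono (Run.loop_next (Run.bind (e := some s) (run_pop ..) (T' := 2) ?_) h) (by omega)
    rcases s with _ | _ | _ | _ | _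
    any_goals exact Run.seq (run_push ..) (run_ret ..)
    exact absurd rfl hw.1

theorem run_back_tree_a (v : Tree) (m a b c : List Γ') :
    (back .a).Run ⟨m, teeList true (.comma :: v.word) a, b, c⟩ (3 * v.size + 2) ()
      ⟨v.word ++ m, a, b, c⟩ := by
  have h := run_back_a v.word.reverse (by simpa using v.comma_notMem_word) m a b c
  simpa [teeList, Tree.size] using h

theorem run_back_tree_b (v : Tree) (m a b c : List Γ') :
    (back .b).Run ⟨m, a, teeList true (.comma :: v.word) b, c⟩ (3 * v.size + 2) ()
      ⟨v.word ++ m, a, b, c⟩ := by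
  have h := run_back_b v.word.reverse (by simpa using v.comma_notMem_word) m a b c
  simpa [teeList, Tree.size] using h

/-- Remove the top tree. -/
def drop : Frag Unit := move false false

theorem run_drop (v : Tree) (m a b c : List Γ') :
    drop.Run ⟨v.word ++ m, a, b, c⟩ (5 * v.size + 3) () ⟨m, a, b, c⟩ :=
  run_move false false v m a b c

/-- Duplicate the top tree. -/
def dup : Frag Unit := (move true true).seq ((back .a).seq (back .b))

theorem run_dup (v : Tree) (m a b c : List Γ') :
    dup.Run ⟨v.word ++ m, a, b, c⟩ (11 * v.size + 7) () ⟨v.word ++ (v.word ++ m), a, b, c⟩ :=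
  Run.mono (Run.seq (run_move ..) (Run.seq (run_back_tree_a ..) (run_back_tree_b ..))) (by omega)

/-- Exchange the two top trees. -/
def swap : Frag Unit := (move true false).seq ((move false true).seq ((back .a).seq (back .b)))

theorem run_swap (v w : Tree) (m a b c : List Γ') :
    swap.Run ⟨v.word ++ (w.word ++ m), a, b, c⟩ (8 * v.size + 8 * w.size + 10) ()
      ⟨w.word ++ (v.word ++ m), a, b, c⟩ :=
  Run.mono (Run.seq (run_move true false v ..) (Run.seq (run_move false true w ..)
    (Run.seq (run_back_tree_a v ..) (run_back_tree_b ..)))) (by omega)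

/-- Push a word. -/
def pushWord : List Γ' → Frag Unit
  | [] => ret ()
  | s :: w => (pushWord w).seq (push .m s)

theorem run_pushWord (w m a b c : List Γ') :
    (pushWord w).Run ⟨m, a, b, c⟩ (w.length + 1) () ⟨w ++ m, a, b, c⟩ := by
  induction w with
  | nil => exact run_ret _ _
  | cons s w ih => exact Run.mono (Run.seq ih (run_push ..)) (by simp)

/-- Remove the symbols of an auxiliary stack down to the next mark. -/
def drain (k : Reg) : Frag Unit :=
  loop ((pop k).bind fun
    | some .comma => ret (some ())
    | some _ => ret none
    | none => ret (some ()))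

theorem run_drain_a (w : List Γ') (hw : Γ'.comma ∉ w) (m a b c : List Γ') :
    (drain .a).Run ⟨m, w ++ .comma :: a, b, c⟩ (2 * w.length + 2) () ⟨m, a, b, c⟩ := by
  induction w with
  | nil =>
    exact Run.mono (Run.loop_exit (Run.bind (e := some Γ'.comma) (run_pop ..) (run_ret ..))) le_rfl
  | cons s w ih =>
    simp only [List.mem_cons, not_or] at hw
    rw [List.length_cons]
    refine Run.mono (Run.loop_next (Run.bind (e := some s) (run_pop ..) (T' := 1) ?_)
      (ih hw.2)) (by omega)
    rcases s with _ | _ | _ | _ | _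
    any_goals exact run_ret ..
    exact absurd rfl hw.1

theorem run_drain_b (w : List Γ') (hw : Γ'.comma ∉ w) (m a b c : List Γ') :
    (drain .b).Run ⟨m, a, w ++ .comma :: b, c⟩ (2 * w.length + 2) () ⟨m, a, b, c⟩ := by
  induction w with
  | nil =>
    exact Run.mono (Run.loop_exit (Run.bind (e := some Γ'.comma) (run_pop ..) (run_ret ..))) le_rfl
  | cons s w ih =>
    simp only [List.mem_cons, not_or] at hw
    rw [List.length_cons]
    refine Run.mono (Run.loop_next (Run.bind (e := some s) (run_pop ..) (T' := 1) ?_)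
      (ih hw.2)) (by omega)
    rcases s with _ | _ | _ | _ | _
    any_goals exact run_ret ..
    exact absurd rfl hw.1

/-- Compare the symbols of the stacks `a` and `b` down to the next marks, removing them. -/
def compare : Frag Bool :=
  loop ((pop .a).bind fun x => (pop .b).bind fun y =>
    if x = some .comma then
      if y = some .comma then ret (some true) else (drain .b).seq (ret (some false))
    else if y = some .comma then (drain .a).seq (ret (some false))
    else if x = y then ret none
    else (drain .a).seq ((drain .b).seq (ret (some false))))

theorem run_compare (w : List Γ') (hw : Γ'.comma ∉ w) : ∀ (w' : List Γ') (_ : Γ'.comma ∉ w')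
    (m a b c : List Γ'), compare.Run ⟨m, w ++ .comma :: a, w' ++ .comma :: b, c⟩
      (3 * w.length + 3 * w'.length + 7) (decide (w = w')) ⟨m, a, b, c⟩ := by
  induction w with
  | nil =>
    rintro (_ | ⟨s, w'⟩) hw' m a b c
    · refine Run.mono (Run.loop_exit (Run.bind (e := some Γ'.comma) (run_pop ..)
        (Run.bind (e := some Γ'.comma) (run_pop ..) (T' := 1) ?_))) (by omega)
      exact run_ret _ _
    · simp only [List.mem_cons, not_or] at hw'
      refine Run.mono (Run.loop_exit (Run.bind (e := some Γ'.comma) (run_pop ..)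
        (Run.bind (e := some s) (run_pop ..) (T' := 2 * w'.length + 2 + 1) ?_)))
        (by rw [List.length_cons]; omega)
      simp only [↓reduceIte, Option.some.injEq, Ne.symm hw'.1, reduceCtorEq, decide_false]
      exact Run.seq (run_drain_b w' hw'.2 ..) (run_ret _ _)
  | cons s w ih =>
    simp only [List.mem_cons, not_or] at hw
    rintro (_ | ⟨s', w'⟩) hw' m a b c
    · refine Run.mono (Run.loop_exit (Run.bind (e := some s) (run_pop ..)
        (Run.bind (e := some Γ'.comma) (run_pop ..) (T' := 2 * w.length + 2 + 1) ?_)))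
        (by rw [List.length_cons]; omega)
      simp only [↓reduceIte, Option.some.injEq, Ne.symm hw.1, reduceCtorEq, decide_false]
      exact Run.seq (run_drain_a w hw.2 ..) (run_ret _ _)
    · simp only [List.mem_cons, not_or] at hw'
      by_cases hs : s = s'
      · subst hs
        have h := ih hw.2 w' hw'.2 m a b c
        rw [show decide (s :: w = s :: w') = decide (w = w') by simp]
        refine Run.mono (Run.loop_next (Run.bind (e := some s) (run_pop ..)
          (Run.bind (e := some s) (run_pop ..) (T' := 1) ?_)) h)
          (by simp only [List.length_cons]; omega)
        simp only [↓reduceIte, Option.some.injEq, Ne.symm hw.1]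
        exact run_ret _ _
      · refine Run.mono (Run.loop_exit (Run.bind (e := some s) (run_pop ..)
          (Run.bind (e := some s') (run_pop ..)
            (T' := 2 * w.length + 2 + (2 * w'.length + 2 + 1)) ?_)))
          (by simp only [List.length_cons]; omega)
        simp only [↓reduceIte, Option.some.injEq, Ne.symm hw.1, Ne.symm hw'.1, hs,
          List.cons.injEq, false_and, decide_false]
        exact Run.seq (run_drain_a w hw.2 ..) (Run.seq (run_drain_b w' hw'.2 ..) (run_ret _ _))

/-- Remove the two top trees and tell whether they are equal. -/
def treeEq : Frag Bool := (move true false).seq ((move false true).seq compare)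

open scoped Classical in
theorem run_treeEq (v w : Tree) (m a b c : List Γ') :
    treeEq.Run ⟨v.word ++ (w.word ++ m), a, b, c⟩ (8 * v.size + 8 * w.size + 13)
      (decide (v = w)) ⟨m, a, b, c⟩ := by
  have h := run_compare v.word.reverse (by simpa using v.comma_notMem_word) w.word.reverse
    (by simpa using w.comma_notMem_word) m a b c
  have h' := (run_move true false v (w.word ++ m) a b c).seq ((run_move false true w m _ b c).seq
    (G := compare) (by simpa [teeList] using h))
  rw [show decide (v = w) = decide (v.word = w.word) by simp [Tree.word_injective.eq_iff]]
  exact Run.mono h' (by simp only [Tree.size]; omega)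

end Frag

/-! ### Functions that fragments compute in polynomial time -/

theorem eval_mono (p : Polynomial ℕ) {x y : ℕ} (h : x ≤ y) : p.eval x ≤ p.eval y := by
  rw [Polynomial.eval_eq_sum, Polynomial.eval_eq_sum]
  exact Finset.sum_le_sum fun i _ => Nat.mul_le_mul_left _ (Nat.pow_le_pow_left h i)

/-- Types whose elements are coded by trees. -/
class Enc (α : Type) where
  /-- the code -/
  enc : α → Tree
  /-- different elements have different codes -/
  inj : Function.Injective enc

open Enc (enc)

/-- The size of the code. -/
def sz {α : Type} [Enc α] (a : α) : ℕ := (enc a).size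

theorem sz_pos {α : Type} [Enc α] (a : α) : 0 < sz a := Tree.size_pos _

variable {α β γ σ : Type} [Enc α] [Enc β] [Enc γ] [Enc σ]

/-- The words are 100 for `true` and 0 for `false`: the first symbol decides a test, and after
`true` two more symbols have to be removed. -/
instance : Enc Bool where
  enc b := bif b then .node .leaf .leaf else .leaf
  inj := by rintro (_ | _) (_ | _) <;> simp

instance : Enc (α × β) where
  enc p := .node (enc p.1) (enc p.2)
  inj p q h := by
    simp only [Tree.node.injEq] at h
    exact Prod.ext (Enc.inj h.1) (Enc.inj h.2)

/-- The code of a list. -/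
def encodeList : List α → Tree
  | [] => .leaf
  | a :: l => .node (enc a) (encodeList l)

/-- A nonempty list has the same code as the pair of its head and tail, so passing between the two
costs nothing. -/
instance : Enc (List α) where
  enc := encodeList
  inj l := by
    induction l with
    | nil => rintro (_ | _) h <;> simp [encodeList] at h ⊢
    | cons a l ih =>
      rintro (_ | ⟨b, l'⟩) h
      · simp [encodeList] at h
      · simp only [encodeList, Tree.node.injEq] at h
        rw [Enc.inj h.1, ih h.2]

theorem sz_pair (a : α) (b : β) : sz (a, b) = sz a + sz b + 1 := Tree.size_node _ _

@[simp] theorem sz_nil : sz ([] : List α) = 1 := rfl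

theorem sz_cons (a : α) (l : List α) : sz (a :: l) = sz a + sz l + 1 := Tree.size_node _ _

theorem length_lt_sz (l : List α) : l.length < sz l := by
  induction l with
  | nil => simp
  | cons a l ih => rw [sz_cons, List.length_cons]; omega

theorem sz_append (l l' : List α) : sz (l ++ l') + 1 = sz l + sz l' := by
  induction l with
  | nil => simp [add_comm]
  | cons a l ih => rw [List.cons_append, sz_cons, sz_cons]; omega

theorem sz_le_of_mem {a : α} {l : List α} (h : a ∈ l) : sz a ≤ sz l := by
  induction l with
  | nil => simp at h
  | cons b l ih =>
    rw [sz_cons]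
    rcases List.mem_cons.1 h with rfl | h
    · omega
    · have := ih h; omega

theorem sz_bool_le (b : Bool) : sz b ≤ 3 := by cases b <;> decide

/-- Some fragment computes `f` in polynomial time, on codes on top of the main stack. -/
def PolyTime (f : α → β) : Prop :=
  ∃ (F : Frag Unit) (p : Polynomial ℕ), ∀ a, sz (f a) ≤ p.eval (sz a) ∧
    ∀ m x y z, F.Run ⟨(enc a).word ++ m, x, y, z⟩ (p.eval (sz a)) ()
      ⟨(enc (f a)).word ++ m, x, y, z⟩

/-! ### Basic closure properties of polynomial-time functions -/

namespace PolyTime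

open Frag Polynomial

theorem size_le {f : α → β} (hf : PolyTime f) : ∃ p : ℕ[X], ∀ a, sz (f a) ≤ p.eval (sz a) :=
  let ⟨_, p, h⟩ := hf; ⟨p, fun a => (h a).1⟩

/-- Codes are untyped, so a map that preserves them needs no work on the stacks. -/
theorem of_enc_eq {f : α → β} (h : ∀ a, enc (f a) = enc a) : PolyTime f := by
  refine ⟨ret (), X + 1, fun a => ⟨?_, fun m x y z => ?_⟩⟩
  · simp [sz, h a]
  · rw [h a]
    exact Run.mono (run_ret ..) (by simp)

theorem id : PolyTime (fun a : α => a) := of_enc_eq fun _ => rfl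

theorem comp {g : β → γ} {f : α → β} (hg : PolyTime g) (hf : PolyTime f) :
    PolyTime fun a => g (f a) := by
  obtain ⟨G, q, hg⟩ := hg
  obtain ⟨F, p, hf⟩ := hf
  refine ⟨F.seq G, p + q.comp p, fun a => ?_⟩
  have h := eval_mono q (hf a).1
  simp only [eval_add, eval_comp]
  exact ⟨((hg (f a)).1.trans h).trans (Nat.le_add_left _ _), fun m x y z =>
    Run.mono (Run.seq ((hf a).2 ..) ((hg (f a)).2 ..)) (by omega)⟩

theorem const (b : β) : PolyTime fun _ : α => b := by
  refine ⟨drop.seq (pushWord (enc b).word), 5 * X + C (sz b + 4), fun a => ⟨by simp; omega, ?_⟩⟩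
  intro m x y z
  refine Run.mono (Run.seq (run_drop ..) (run_pushWord ..)) ?_
  simp only [eval_add, eval_mul, eval_X, eval_C, eval_ofNat]
  simp only [sz, Tree.size]; omega

theorem pair {f : α → β} {g : α → γ} (hf : PolyTime f) (hg : PolyTime g) :
    PolyTime fun a => (f a, g a) := by
  obtain ⟨F, p, hf⟩ := hf
  obtain ⟨G, q, hg⟩ := hg
  -- `g` is computed first: after the swap and `f`, the two values lie in prefix order and only the
  -- node symbol is missing.
  refine ⟨dup.seq (G.seq (swap.seq (F.seq (push .m (.bit true))))),
    19 * X + 18 + p + 9 * q, fun a => ?_⟩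
  have h₁ := (hf a).1
  have h₂ := (hg a).1
  simp only [eval_add, eval_mul, eval_X, eval_ofNat]
  refine ⟨by rw [sz_pair]; omega, fun m x y z => ?_⟩
  have h : (enc (f a, g a)).word ++ m =
      .bit true :: ((enc (f a)).word ++ ((enc (g a)).word ++ m)) := by
    simp [enc, Tree.word]
  rw [h]
  refine Run.mono (Run.seq (run_dup (enc a) ..) (Run.seq ((hg a).2 ..)
    (Run.seq (run_swap (enc (g a)) (enc a) ..) (Run.seq ((hf a).2 ..) (run_push ..))))) ?_
  simp only [sz] at *
  omega

theorem fst : PolyTime (Prod.fst : α × β → α) := by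
  refine ⟨(pop .m).bind fun _ => swap.seq drop, 20 * X + 20, fun a => ?_⟩
  simp only [eval_add, eval_mul, eval_X, eval_ofNat]
  have h : sz a = sz a.1 + sz a.2 + 1 := sz_pair a.1 a.2
  refine ⟨by omega, fun m x y z => ?_⟩
  have h' : (enc a).word ++ m = .bit true :: ((enc a.1).word ++ ((enc a.2).word ++ m)) := by
    simp [enc, Tree.word]
  rw [h']
  refine Run.mono (Run.bind (e := some (Γ'.bit true)) (run_pop ..)
    (Run.seq (run_swap (enc a.1) (enc a.2) ..) (run_drop (enc a.2) ..))) ?_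
  simp only [sz] at *
  omega

theorem snd : PolyTime (Prod.snd : α × β → β) := by
  refine ⟨(pop .m).bind fun _ => drop, 20 * X + 20, fun a => ?_⟩
  simp only [eval_add, eval_mul, eval_X, eval_ofNat]
  have h : sz a = sz a.1 + sz a.2 + 1 := sz_pair a.1 a.2
  refine ⟨by omega, fun m x y z => ?_⟩
  have h' : (enc a).word ++ m = .bit true :: ((enc a.1).word ++ ((enc a.2).word ++ m)) := by
    simp [enc, Tree.word]
  rw [h']
  refine Run.mono (Run.bind (e := some (Γ'.bit true)) (run_pop ..) (run_drop (enc a.1) ..)) ?_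
  simp only [sz] at *
  omega

theorem tail : PolyTime (List.tail : List α → List α) := by
  refine ⟨(pop .m).bind fun
    | some (.bit true) => drop
    | _ => push .m (.bit false), 20 * X + 20, fun a => ?_⟩
  simp only [eval_add, eval_mul, eval_X, eval_ofNat]
  rcases a with _ | ⟨a, l⟩
  · refine ⟨by simp, fun m x y z => ?_⟩
    exact Run.mono (Run.bind (e := some (Γ'.bit false)) (run_pop ..) (run_push ..)) (by omega)
  · have h := sz_cons a l
    refine ⟨by simp only [List.tail_cons]; omega, fun m x y z => ?_⟩
    have h' : (enc (a :: l)).word ++ m = .bit true :: ((enc a).word ++ ((enc l).word ++ m)) := by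
      simp [enc, Tree.word, encodeList]
    rw [h']
    refine Run.mono (Run.bind (e := some (Γ'.bit true)) (run_pop ..) (run_drop (enc a) ..)) ?_
    simp only [sz] at *
    omega

theorem headD (d : α) : PolyTime fun l : List α => l.headD d := by
  refine ⟨(pop .m).bind fun
    | some (.bit true) => swap.seq drop
    | _ => pushWord (enc d).word, 20 * X + C (20 + sz d), fun a => ?_⟩
  simp only [eval_add, eval_mul, eval_X, eval_ofNat, eval_C]
  rcases a with _ | ⟨a, l⟩
  · refine ⟨by simp; omega, fun m x y z => ?_⟩
    refine Run.mono (Run.bind (e := some (Γ'.bit false)) (run_pop ..) (run_pushWord ..)) ?_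
    simp only [sz, Tree.size]; omega
  · have h := sz_cons a l
    refine ⟨by simp only [List.headD_cons]; omega, fun m x y z => ?_⟩
    have h' : (enc (a :: l)).word ++ m = .bit true :: ((enc a).word ++ ((enc l).word ++ m)) := by
      simp [enc, Tree.word, encodeList]
    rw [h']
    refine Run.mono (Run.bind (e := some (Γ'.bit true)) (run_pop ..)
      (Run.seq (run_swap (enc a) (enc l) ..) (run_drop (enc l) ..))) ?_
    simp only [sz] at *
    omega

theorem cond {c : α → Bool} {f g : α → β} (hc : PolyTime c) (hf : PolyTime f) (hg : PolyTime g) :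
    PolyTime fun a => bif c a then f a else g a := by
  obtain ⟨K, r, hc⟩ := hc
  obtain ⟨F, p, hf⟩ := hf
  obtain ⟨G, q, hg⟩ := hg
  refine ⟨dup.seq (K.seq ((pop .m).bind fun
    | some (.bit true) => (pop .m).bind fun _ => (pop .m).bind fun _ => F
    | _ => G)), 11 * X + 10 + p + q + r, fun a => ?_⟩
  have h₁ := (hf a).1
  have h₂ := (hg a).1
  have h₃ := (hc a).2
  simp only [eval_add, eval_mul, eval_X, eval_ofNat]
  cases hca : c a
  · rw [hca] at h₃
    refine ⟨by simp only [cond_false]; omega, fun m x y z => ?_⟩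
    refine Run.mono (Run.seq (run_dup (enc a) ..) (Run.seq (h₃ ..)
      (Run.bind (e := some (Γ'.bit false)) (run_pop ..) ((hg a).2 ..)))) ?_
    simp only [sz] at *
    omega
  · rw [hca] at h₃
    refine ⟨by simp only [cond_true]; omega, fun m x y z => ?_⟩
    refine Run.mono (Run.seq (run_dup (enc a) ..) (Run.seq (h₃ ..)
      (Run.bind (e := some (Γ'.bit true)) (run_pop ..) (Run.bind (e := some (Γ'.bit false))
        (run_pop ..) (Run.bind (e := some (Γ'.bit false)) (run_pop ..) ((hf a).2 ..)))))) ?_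
    simp only [sz] at *
    omega

theorem decide_eq_pair [DecidableEq α] : PolyTime fun p : α × α => decide (p.1 = p.2) := by
  classical
  refine ⟨(pop .m).bind fun _ => treeEq.bind fun b => pushWord (enc b).word,
    20 * X + 20, fun a => ?_⟩
  simp only [eval_add, eval_mul, eval_X, eval_ofNat]
  have h : sz a = sz a.1 + sz a.2 + 1 := sz_pair a.1 a.2
  have hb := sz_bool_le (decide (a.1 = a.2))
  refine ⟨by omega, fun m x y z => ?_⟩
  have h' : (enc a).word ++ m = .bit true :: ((enc a.1).word ++ ((enc a.2).word ++ m)) := by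
    simp [enc, Tree.word]
  have h₂ := run_treeEq (enc a.1) (enc a.2) m x y z
  rw [show decide (enc a.1 = enc a.2) = decide (a.1 = a.2) by simp [Enc.inj.eq_iff]] at h₂
  rw [h']
  refine Run.mono (Run.bind (e := some (Γ'.bit true)) (run_pop ..)
    (Run.bind h₂ (run_pushWord ..))) ?_
  simp only [sz, Tree.size] at *
  omega

theorem decide_eq [DecidableEq β] {f g : α → β} (hf : PolyTime f) (hg : PolyTime g) :
    PolyTime fun a => decide (f a = g a) :=
  decide_eq_pair.comp (hf.pair hg)

/-- The loop that runs a fragment as long as a list in the first component is not empty. -/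
def whileCons (B : Frag Unit) : Frag Unit :=
  loop ((pop .m).bind fun _ => (pop .m).bind fun
    -- The word of `(a :: l, (s, b))` is also the word of `((a, l), (s, b))`, so putting back the
    -- two symbols just read gives `B` its argument.
    | some (.bit true) => (pushWord [.bit true, .bit true]).seq (B.seq (ret none))
    | _ => (pushWord [.bit true, .bit false]).seq (ret (some ())))

/-- `N` bounds the size of every state reached, so a single time bound serves all iterations. -/
theorem run_whileCons {f : σ → β → α → β} {B : Frag Unit} {p : ℕ[X]}
    (hB : ∀ q : (α × List α) × (σ × β), ∀ m x y z, B.Run ⟨(enc q).word ++ m, x, y, z⟩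
      (p.eval (sz q)) ()
      ⟨(enc (q.1.2, (q.2.1, f q.2.1 q.2.2 q.1.1))).word ++ m, x, y, z⟩) (N : ℕ) (s : σ)
    (m x y z : List Γ') (l : List α) : ∀ b : β,
    (∀ l₁ l₂, l = l₁ ++ l₂ → sz (l₂, (s, l₁.foldl (f s) b)) ≤ N) →
    (whileCons B).Run ⟨(enc (l, (s, b))).word ++ m, x, y, z⟩ (l.length * (p.eval N + 6) + 6) ()
      ⟨(enc (([] : List α), (s, l.foldl (f s) b))).word ++ m, x, y, z⟩ := by
  induction l with
  | nil =>
    intro b _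
    exact Run.mono (Run.loop_exit (Run.bind (e := some (Γ'.bit true)) (run_pop ..)
      (Run.bind (e := some (Γ'.bit false)) (run_pop ..)
        (Run.seq (run_pushWord ..) (run_ret ..))))) (by simp)
  | cons a l ih =>
    intro b hb
    have h₁ := ih (f s b a) fun l₁ l₂ h => by
      have := hb (a :: l₁) l₂ (by rw [h]; rfl)
      simpa using this
    have h₂ := hB ((a, l), (s, b)) m x y z
    have h₃ : p.eval (sz ((a, l), (s, b))) ≤ p.eval N := eval_mono p (hb [] (a :: l) rfl)
    refine Run.mono (Run.loop_next (Run.bind (e := some (Γ'.bit true)) (run_pop ..)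
      (Run.bind (e := some (Γ'.bit true)) (run_pop ..)
        (Run.seq (run_pushWord ..) (Run.seq h₂ (run_ret ..))))) h₁) ?_
    simp only [List.length_cons, List.length_nil, add_mul]
    omega

/-- Iterating a polynomial-time map can blow up sizes, hence the bound `hb` on all partial folds.
With it, there are polynomially many rounds, each on an argument of polynomial size. -/
theorem foldl {l : σ → List α} {i : σ → β} {f : σ × β × α → β} (hl : PolyTime l)
    (hi : PolyTime i) (hf : PolyTime f)
    (hb : ∃ q : ℕ[X], ∀ s l₁ l₂, l s = l₁ ++ l₂ → sz (l₁.foldl (fun b a => f (s, b, a)) (i s)) ≤ q.eval (sz s)) :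
    PolyTime fun s => (l s).foldl (fun b a => f (s, b, a)) (i s) := by
  obtain ⟨q, hb⟩ := hb
  have hB : PolyTime fun q : (α × List α) × (σ × β) =>
      (q.1.2, (q.2.1, f (q.2.1, q.2.2, q.1.1))) :=
    (snd.comp fst).pair ((fst.comp snd).pair (hf.comp ((fst.comp snd).pair
      ((snd.comp snd).pair (fst.comp fst)))))
  obtain ⟨B, p, hB⟩ := hB
  obtain ⟨pl, hpl⟩ := hl.size_le
  have hW : PolyTime fun s => (([] : List α), (s, (l s).foldl (fun b a => f (s, b, a)) (i s))) := by
    obtain ⟨I, r, hI⟩ := hl.pair (PolyTime.id.pair hi)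
    -- Initialisation, at most `pl` rounds, the final test, then the size of the result. A state
    -- consists of a remaining list, the parameter, an accumulator and two pairing nodes, whence `pl
    -- + X + q + 2`.
    refine ⟨I.seq (whileCons B), r + pl * (p.comp (pl + X + q + 2) + 6) + 6 + (X + q + 3),
      fun s => ?_⟩
    have h₁ := hb s (l s) [] (by simp)
    simp only [eval_add, eval_mul, eval_X, eval_ofNat, eval_comp]
    refine ⟨?_, fun m x y z => ?_⟩
    · rw [sz_pair, sz_pair, sz_nil]; omega
    have h₂ := run_whileCons (f := fun s b a => f (s, b, a)) (fun q => (hB q).2) ((pl + X + q + 2).eval (sz s)) s m x y z (l s)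
      (i s) fun l₁ l₂ h => by
        have h₃ := hb s l₁ l₂ h
        have h₄ := hpl s
        have h₅ := sz_append l₁ l₂
        have h₆ := sz_pos l₁
        rw [h] at h₄
        rw [sz_pair, sz_pair]
        simp only [eval_add, eval_X, eval_ofNat]
        omega
    refine Run.mono (Run.seq ((hI s).2 ..) h₂) ?_
    simp only [eval_add, eval_X, eval_ofNat]
    have h₇ : (l s).length ≤ pl.eval (sz s) := (length_lt_sz _).le.trans (hpl s)
    have h₈ := Nat.mul_le_mul_right (p.eval (pl.eval (sz s) + sz s + q.eval (sz s) + 2) + 6) h₇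
    omega
  exact (snd.comp snd).comp hW

/-- An additive increment that depends on `s` alone cannot compound, so the partial folds stay
polynomial. -/
theorem foldl_of_growth {l : σ → List α} {i : σ → β} {f : σ × β × α → β} (hl : PolyTime l)
    (hi : PolyTime i) (hf : PolyTime f)
    (hg : ∃ q : ℕ[X], ∀ s b, ∀ a ∈ l s, sz (f (s, b, a)) ≤ sz b + q.eval (sz s)) :
    PolyTime fun s => (l s).foldl (fun b a => f (s, b, a)) (i s) := by
  obtain ⟨q, hg⟩ := hg
  obtain ⟨pl, hpl⟩ := hl.size_le
  obtain ⟨pi, hpi⟩ := hi.size_le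
  refine foldl hl hi hf ⟨pi + pl * q, fun s l₁ l₂ h => ?_⟩
  have key : ∀ (l' : List α), (∀ a ∈ l', a ∈ l s) → ∀ b,
      sz (l'.foldl (fun b a => f (s, b, a)) b) ≤ sz b + l'.length * q.eval (sz s) := by
    intro l'
    induction l' with
    | nil => simp
    | cons a l' ih =>
      intro h b
      have h₁ := ih (fun x hx => h x (List.mem_cons_of_mem _ hx)) (f (s, b, a))
      have h₂ := hg s b a (h a List.mem_cons_self)
      simp only [List.foldl_cons, List.length_cons, add_mul]
      omega
  have h₁ := key l₁ (fun a ha => by rw [h]; exact List.mem_append_left _ ha) (i s)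
  have h₂ := hpi s
  have h₃ : l₁.length ≤ pl.eval (sz s) := by
    have h₄ := length_lt_sz (l s)
    have h₅ := congrArg List.length h
    have h₆ := hpl s
    rw [List.length_append] at h₅
    omega
  have h₄ := Nat.mul_le_mul_right (q.eval (sz s)) h₃
  simp only [eval_add, eval_mul]
  omega

/-- The values of a polynomial-time function on the entries of a list have polynomial size. -/
theorem size_entry_le {l : σ → List α} {f : σ × α → β} (hl : PolyTime l)
    (hf : PolyTime f) :
    ∃ q : ℕ[X], ∀ s, ∀ a ∈ l s, sz (f (s, a)) ≤ q.eval (sz s) := by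
  obtain ⟨p, hp⟩ := hf.size_le
  obtain ⟨pl, hpl⟩ := hl.size_le
  refine ⟨p.comp (X + pl + 1), fun s a ha => (hp (s, a)).trans ?_⟩
  rw [eval_comp]
  refine eval_mono p ?_
  have h₁ := sz_le_of_mem ha
  have h₂ := hpl s
  simp only [eval_add, eval_X, eval_one]
  rw [sz_pair]
  omega

/-! ### Polynomial-time operations on lists -/

theorem cons {f : σ → α} {g : σ → List α} (hf : PolyTime f) (hg : PolyTime g) :
    PolyTime fun s => f s :: g s :=
  (of_enc_eq (f := fun p : α × List α => p.1 :: p.2) fun _ => rfl).comp (hf.pair hg)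

theorem reverseAux {f g : σ → List α} (hf : PolyTime f) (hg : PolyTime g) :
    PolyTime fun s => (f s).reverse ++ g s := by
  have h := foldl_of_growth (f := fun q => q.2.2 :: q.2.1) hf hg
    ((snd.comp snd).cons (fst.comp snd)) ?_
  · simpa using h
  · obtain ⟨p, hp⟩ := hf.size_le
    refine ⟨p + 1, fun s b a ha => ?_⟩
    have h₁ := sz_le_of_mem ha
    have h₂ := hp s
    simp only [eval_add, eval_one, sz_cons]
    omega

theorem reverse {f : σ → List α} (hf : PolyTime f) : PolyTime fun s => (f s).reverse := by
  simpa using hf.reverseAux (const [])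

theorem append {f g : σ → List α} (hf : PolyTime f) (hg : PolyTime g) :
    PolyTime fun s => f s ++ g s := by
  simpa using hf.reverse.reverseAux hg

theorem map {l : σ → List α} {f : σ × α → β} (hl : PolyTime l)
    (hf : PolyTime f) : PolyTime fun s => (l s).map fun a => f (s, a) := by
  have h := foldl_of_growth (f := fun q => f (q.1, q.2.2) :: q.2.1) hl (const ([] : List β))
    ((hf.comp (fst.pair (snd.comp snd))).cons (fst.comp snd)) ?_
  · simpa using h.reverse
  · obtain ⟨p, hp⟩ := size_entry_le hl hf
    refine ⟨p + 1, fun s b a ha => ?_⟩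
    have h₁ := hp s a ha
    simp only [eval_add, eval_one, sz_cons]
    omega

theorem filter {l : σ → List α} {f : σ × α → Bool} (hl : PolyTime l)
    (hf : PolyTime f) : PolyTime fun s => (l s).filter fun a => f (s, a) := by
  have h := foldl_of_growth (f := fun q => bif f (q.1, q.2.2) then q.2.2 :: q.2.1 else q.2.1) hl
    (const ([] : List α)) ((hf.comp (fst.pair (snd.comp snd))).cond
      ((snd.comp snd).cons (fst.comp snd)) (fst.comp snd)) ?_
  · convert h.reverse using 2 with s
    have key : ∀ l b : List α, l.foldl (fun l a => bif f (s, a) then a :: l else l) b =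
        (l.filter fun a => f (s, a)).reverse ++ b := by
      intro l
      induction l with
      | nil => simp
      | cons a l ih => intro b; cases h : f (s, a) <;> simp [ih, h]
    simp [key]
  · obtain ⟨p, hp⟩ := hl.size_le
    refine ⟨p + 1, fun s b a ha => ?_⟩
    have h₁ := sz_le_of_mem ha
    have h₂ := hp s
    simp only [eval_add, eval_one]
    cases f (s, a)
    · simp
    · simp only [cond_true, sz_cons]; omega

theorem not {f : σ → Bool} (hf : PolyTime f) : PolyTime fun s => !f s := by
  convert hf.cond (const false) (const true) using 2 with s
  cases f s <;> rfl

theorem and {f g : σ → Bool} (hf : PolyTime f) (hg : PolyTime g) :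
    PolyTime fun s => f s && g s := by
  convert hf.cond hg (const false) using 2 with s
  cases f s <;> rfl

theorem or {f g : σ → Bool} (hf : PolyTime f) (hg : PolyTime g) :
    PolyTime fun s => f s || g s := by
  convert hf.cond (const true) hg using 2 with s
  cases f s <;> rfl

theorem isEmpty {l : σ → List α} (hl : PolyTime l) : PolyTime fun s => (l s).isEmpty := by
  classical
  convert hl.decide_eq (const []) using 2 with s
  cases l s <;> simp

theorem all {l : σ → List α} {f : σ × α → Bool} (hl : PolyTime l)
    (hf : PolyTime f) : PolyTime fun s => (l s).all fun a => f (s, a) := by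
  convert (hl.filter hf.not).isEmpty using 2 with s
  rw [Bool.eq_iff_iff]
  simp

theorem any {l : σ → List α} {f : σ × α → Bool} (hl : PolyTime l)
    (hf : PolyTime f) : PolyTime fun s => (l s).any fun a => f (s, a) := by
  convert (hl.all hf.not).not using 2 with s
  rw [Bool.eq_iff_iff]
  simp

theorem mem {l : σ → List α} {f : σ → α} [∀ s, Decidable (f s ∈ l s)] (hl : PolyTime l)
    (hf : PolyTime f) : PolyTime fun s => decide (f s ∈ l s) := by
  classical
  convert hl.any ((hf.comp fst).decide_eq snd) using 2 with s
  rw [Bool.eq_iff_iff]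
  simp

theorem flatten {l : σ → List (List α)} (hl : PolyTime l) : PolyTime fun s => (l s).flatten := by
  have h := foldl_of_growth (f := fun q => q.2.1 ++ q.2.2) hl (const ([] : List α))
    ((fst.comp snd).append (snd.comp snd)) ?_
  · convert h using 2 with s
    have key : ∀ (l : List (List α)) (b : List α),
        l.foldl (fun l a => l ++ a) b = b ++ l.flatten := by
      intro l
      induction l with
      | nil => simp
      | cons a l ih => intro b; simp [ih]
    simp [key]
  · obtain ⟨p, hp⟩ := hl.size_le
    refine ⟨p, fun s b a ha => ?_⟩
    have h₁ := sz_le_of_mem ha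
    have h₂ := hp s
    have h₃ := sz_append b a
    simp only
    omega

theorem flatMap {l : σ → List α} {f : σ × α → List β} (hl : PolyTime l)
    (hf : PolyTime f) : PolyTime fun s => (l s).flatMap fun a => f (s, a) := by
  simpa [List.flatMap_def] using (hl.map hf).flatten

theorem nodup [DecidableEq α] {l : σ → List α} (hl : PolyTime l) :
    PolyTime fun s => decide (l s).Nodup := by
  -- An entry occurs only once exactly when the sublist of entries equal to it has an empty tail.
  convert hl.all ((tail.comp ((hl.comp fst).filter
    (snd.decide_eq (snd.comp fst)))).isEmpty) using 2 with s
  rw [Bool.eq_iff_iff]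
  simp only [decide_eq_true_eq, List.nodup_iff_count_le_one, List.all_eq_true]
  constructor
  · intro h a _
    have := h a
    rw [List.count_eq_length_filter] at this
    rw [List.isEmpty_iff_length_eq_zero, List.length_tail]
    simp only [beq_eq_decide, eq_comm] at this ⊢
    omega
  · intro h a
    by_cases ha : a ∈ l s
    · have := h a ha
      rw [List.isEmpty_iff_length_eq_zero, List.length_tail] at this
      rw [List.count_eq_length_filter]
      simp only [beq_eq_decide, eq_comm] at this ⊢
      omega
    · rw [List.count_eq_zero_of_not_mem ha]
      omega

/-- Definition by cases on a value in a finite type. -/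
theorem finite_cases [DecidableEq α] [Fintype α] [Inhabited α] {k : σ → α} {f : α → σ → β}
    (hk : PolyTime k) (hf : ∀ a, PolyTime (f a)) : PolyTime fun s => f (k s) s := by
  -- Induction on the keys that are still told apart; all others are sent to the default, which
  -- makes the empty list a single case.
  have key : ∀ l : List α, PolyTime fun s => f (if k s ∈ l then k s else default) s := by
    intro l
    induction l with
    | nil => simpa using hf default
    | cons a l ih =>
      convert (hk.decide_eq (const a)).cond (hf a) ih using 2 with s
      by_cases h : k s = a <;> simp [h]
  simpa using key Finset.univ.toList

theorem of_finite [DecidableEq α] [Fintype α] [Inhabited α] (f : α → β) : PolyTime f :=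
  finite_cases (f := fun a _ => f a) id fun _ => const _

end PolyTime

/-! ### From fragments to Turing machines -/

/-- A tree for every natural number. -/
def comb : ℕ → Tree
  | 0 => .leaf
  | n + 1 => .node .leaf (comb n)

/-- The index of a symbol of the input alphabet. -/
def symIndex : Γ' → ℕ
  | .blank => 0
  | .bit false => 1
  | .bit true => 2
  | .bra => 3
  | .ket => 4
  | .comma => 5

/-- Combs of different heights are different trees; the highest one used has size 11. -/
instance : Enc Γ' where
  enc s := comb (symIndex s)
  inj := by
    rintro (_ | (_ | _) | _ | _ | _) (_ | (_ | _) | _ | _ | _) <;> simp [comb, symIndex]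

theorem sz_sym_le (s : Γ') : sz s ≤ 11 := by
  rcases s with _ | (_ | _) | _ | _ | _ <;> decide

theorem sz_word_le (w : List Γ') : sz w ≤ 12 * w.length + 1 := by
  induction w with
  | nil => simp
  | cons s w ih =>
    have := sz_sym_le s
    rw [sz_cons, List.length_cons]
    omega

namespace Frag

/-- Move the whole stack `m` to the stack `a`. -/
def flush : Frag Unit :=
  loop ((pop .m).bind fun
    | some s => (push .a s).seq (ret none)
    | none => ret (some ()))

theorem run_flush (w : List Γ') : ∀ a b c : List Γ',
    flush.Run ⟨w, a, b, c⟩ (3 * w.length + 2) () ⟨[], w.reverse ++ a, b, c⟩ := by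
  induction w with
  | nil =>
    intro a b c
    exact Run.mono (Run.loop_exit (Run.bind (e := none) (run_pop ..) (run_ret ..))) le_rfl
  | cons s w ih =>
    intro a b c
    have h := ih (s :: a) b c
    rw [List.reverse_cons, List.append_assoc]
    exact Run.mono (Run.loop_next (Run.bind (e := some s) (run_pop ..)
      (Run.seq (run_push ..) (run_ret ..))) h) (by rw [List.length_cons]; omega)

/-- Put the code of the word on the stack `a` on the stack `m`. -/
def codeSyms : Frag Unit :=
  loop ((pop .a).bind fun
    | some s => (pushWord (.bit true :: (enc s).word)).seq (ret none)
    | none => ret (some ()))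

theorem run_codeSyms (w : List Γ') : ∀ l b c : List Γ',
    codeSyms.Run ⟨(enc l).word, w, b, c⟩ (16 * w.length + 2) ()
      ⟨(enc (w.reverse ++ l)).word, [], b, c⟩ := by
  induction w with
  | nil =>
    intro l b c
    exact Run.mono (Run.loop_exit (Run.bind (e := none) (run_pop ..) (run_ret ..))) le_rfl
  | cons s w ih =>
    intro l b c
    have h := ih (s :: l) b c
    rw [List.reverse_cons, List.append_assoc]
    refine Run.mono (Run.loop_next (Run.bind (e := some s) (run_pop ..)
      (Run.seq (run_pushWord ..) (run_ret ..))) h) ?_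
    have h₁ : (enc s).word.length ≤ 11 := sz_sym_le s
    simp only [List.length_cons]
    omega

/-- Replace a word on the stack `m` by its code. -/
def codeInput : Frag Unit := flush.seq ((push .m (.bit false)).seq codeSyms)

theorem run_codeInput (w : List Γ') :
    codeInput.Run ⟨w, [], [], []⟩ (19 * w.length + 5) () ⟨(enc w).word, [], [], []⟩ := by
  have h := run_codeSyms w.reverse [] [] []
  rw [List.reverse_reverse, List.append_nil, List.length_reverse] at h
  have h' := run_flush w [] [] []
  rw [List.append_nil] at h'
  exact Run.mono (Run.seq h' (Run.seq (run_push ..) h)) (by omega)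

/-- The stack alphabets: one more stack, for the output. -/
abbrev Alphabet : Option Reg → Type
  | none => Bool
  | some _ => Γ'

/-- The statement for an instruction. -/
def stmt {X : Type} : Instr X → Turing.TM2.Stmt Alphabet X (Option Γ')
  | .push k s x => .push (some k) (fun _ => s) (.goto fun _ => x)
  | .pop k f => .pop (some k) (fun _ o => o) (.goto f)
  | .jump x => .goto fun _ => x

/-- The Turing machine that runs a fragment and writes the exit to the output stack. -/
def machine (F : Frag Bool) : Turing.FinTM2 :=
  haveI := F.fin
  { K := Option Reg
    k₀ := some .m
    k₁ := none
    Γ := Alphabet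
    Λ := F.L ⊕ Bool
    main := .inl F.start
    σ := Option Γ'
    initialState := none
    Γk₀Fin := inferInstanceAs (Fintype Γ')
    m
      | .inl l => stmt (F.code l)
      -- The internal state is reset because the halting configuration of the model contains the
      -- initial state.
      | .inr b => .push none (fun _ => b) (.load (fun _ => none) .halt) }

/-- The stacks of the machine. -/
def contents (S : Store) (o : List Bool) : ∀ k, List (Alphabet k)
  | none => o
  | some k => S.get k

theorem update_contents (S : Store) (o : List Bool) (k : Reg) (l : List Γ') :
    Function.update (contents S o) (some k) l = contents (S.set l k) o := by
  funext k'
  rcases k' with _ | k'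
  · rfl
  · by_cases h : k' = k
    · subst h
      refine (Function.update_self (some k') _ (contents S o)).trans ?_
      cases k' <;> rfl
    · refine (Function.update_of_ne (by simpa using h) _ (contents S o)).trans ?_
      cases k <;> cases k' <;> first | rfl | exact absurd rfl h

theorem step_machine (F : Frag Bool) (l : F.L) (v : Option Γ') (S : Store) (o : List Bool) :
    ∃ v', (machine F).step ⟨some (.inl l), v, contents S o⟩ =
      some ⟨some ((F.code l).exec S).1, v', contents ((F.code l).exec S).2 o⟩ := by
  change ∃ v', some (Turing.TM2.stepAux (stmt (F.code l)) v (contents S o)) = _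
  rcases F.code l with ⟨k, s, x⟩ | ⟨k, f⟩ | x
  · exact ⟨v, congrArg (fun T => some (Turing.TM2.Cfg.mk (some x) v T)) (update_contents S o k _)⟩
  · exact ⟨(S.get k).head?, congrArg (fun T =>
      some (Turing.TM2.Cfg.mk (some (f (S.get k).head?)) (S.get k).head? T)) (update_contents S o k _)⟩
  · exact ⟨v, rfl⟩

theorem Steps.machine {F : Frag Bool} {t : ℕ} {x y} (h : F.Steps t x y) : ∀ v : Option Γ', ∃ v',
    (flip Bind.bind (machine F).step)^[t] (some ⟨some x.1, v, contents x.2 []⟩) =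
      some ⟨some y.1, v', contents y.2 []⟩ := by
  induction h with
  | refl x => exact fun v => ⟨v, rfl⟩
  | @step l S t y _ ih =>
    intro v
    obtain ⟨v', hv'⟩ := step_machine F l v S []
    obtain ⟨v'', hv''⟩ := ih v'
    refine ⟨v'', ?_⟩
    rw [Function.iterate_succ_apply, ← hv'']
    exact congrArg _ hv'

/-- The halting configuration demands empty work stacks. The extra step writes the output and halts.
-/
theorem Run.machine {F : Frag Bool} {w : List Γ'} {T : ℕ} {b : Bool}
    (h : F.Run ⟨w, [], [], []⟩ T b ⟨[], [], [], []⟩) :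
    Nonempty (Turing.TM2OutputsInTime (machine F) w (some [b]) (T + 1)) := by
  obtain ⟨t, ht, h⟩ := h
  obtain ⟨v, hv⟩ := h.machine none
  refine ⟨⟨⟨t + 1, ?_⟩, Nat.succ_le_succ ht⟩⟩
  have h₁ : Turing.initList (F.machine) w =
      ⟨some (.inl F.start), none, contents ⟨w, [], [], []⟩ []⟩ := by
    refine congrArg (Turing.TM2.Cfg.mk _ _) (funext fun k => ?_)
    rcases k with _ | (_ | _ | _ | _) <;> rfl
  have h₂ : Turing.haltList (F.machine) [b] =
      ⟨none, none, contents ⟨[], [], [], []⟩ [b]⟩ := by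
    refine congrArg (Turing.TM2.Cfg.mk _ _) (funext fun k => ?_)
    rcases k with _ | (_ | _ | _ | _) <;> rfl
  rw [Function.iterate_succ_apply']
  erw [h₁, hv]
  rw [Option.map_some, h₂]
  change some (Turing.TM2.Cfg.mk none none _) = _
  refine congrArg (fun T => some (Turing.TM2.Cfg.mk none none T)) (funext fun k => ?_)
  rcases k with _ | (_ | _ | _ | _) <;> rfl

end Frag

open Frag Polynomial in
theorem PolyTime.inP {f : List Γ' → Bool} (hf : PolyTime f) {L : Language Γ'}
    (hL : ∀ w, f w = true ↔ w ∈ L) : InP L := by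
  obtain ⟨F, p, hF⟩ := hf
  let H : Frag Bool := codeInput.seq (F.seq ((pop .m).bind fun
    | some (.bit true) => (pop .m).bind fun _ => (pop .m).bind fun _ => ret true
    | _ => ret false))
  -- Coding the input takes `19 * X + 5` steps and yields a tree of size at most `12 * X + 1`; at
  -- most four further steps read and remove the answer.
  have hH : ∀ w, H.Run ⟨w, [], [], []⟩ ((19 * X + p.comp (12 * X + 1) + 9).eval w.length) (f w)
      ⟨[], [], [], []⟩ := by
    intro w
    have h₁ := run_codeInput w
    have h₂ := (hF w).2 [] [] [] []
    rw [List.append_nil, List.append_nil] at h₂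
    have h₃ := eval_mono p (sz_word_le w)
    simp only [eval_add, eval_mul, eval_comp, eval_X, eval_ofNat, eval_one]
    cases hw : f w
    · rw [hw] at h₂
      exact Run.mono (Run.seq h₁ (Run.seq h₂ (Run.bind (e := some (Γ'.bit false)) (run_pop ..)
        (run_ret ..)))) (by omega)
    · rw [hw] at h₂
      exact Run.mono (Run.seq h₁ (Run.seq h₂ (Run.bind (e := some (Γ'.bit true)) (run_pop ..)
        (Run.bind (e := some (Γ'.bit false)) (run_pop ..)
          (Run.bind (e := some (Γ'.bit false)) (run_pop ..) (run_ret ..)))))) (by omega)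
  refine ⟨f, ⟨⟨machine H, Equiv.refl Γ', Equiv.refl Bool⟩,
    19 * X + p.comp (12 * X + 1) + 9 + 1, fun w => ?_⟩, ?_, hL⟩
  · have h := (hH w).machine
    have h' : Turing.TM2OutputsInTime (machine H) w (some [f w])
        ((19 * X + p.comp (12 * X + 1) + 9 + 1 : ℕ[X]).eval w.length) := by
      rw [eval_add, eval_one]
      exact h.some
    have e₁ : List.map (Equiv.refl Γ').invFun (_root_.id w) = w := List.map_id _
    exact e₁.symm ▸ h'
  · rintro (_ | _)
    · exact inferInstanceAs (Finite Bool)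
    · exact inferInstanceAs (Finite Γ')

/-! ### Numbers, cells and the description of a game as data -/

/-- Binary digits are essential: a unary code of a coordinate could be exponentially longer than the
input. -/
instance : Enc ℕ where
  enc n := enc (encodeNat n)
  inj := Enc.inj.comp encodingNatBool.encode_injective

instance : Enc ℤ where
  enc z := enc (decide (z < 0), z.natAbs)
  inj := Enc.inj.comp fun x y h => by
    simp only [Prod.mk.injEq, decide_eq_decide] at h
    omega

/-! ### Binary successor and canonical digits -/

/-- Increment a binary number. -/
def incBits : List Bool → List Bool
  | [] => [true]
  | false :: l => true :: l
  | true :: l => false :: incBits l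

theorem encodePosNum_succ (n : PosNum) : encodePosNum n.succ = incBits (encodePosNum n) := by
  induction n with
  | one => rfl
  | bit1 n ih => simp [PosNum.succ, encodePosNum, incBits, ih]
  | bit0 n ih => simp [PosNum.succ, encodePosNum, incBits]

theorem encodeNat_succ (n : ℕ) : encodeNat (n + 1) = incBits (encodeNat n) := by
  unfold encodeNat
  rw [Nat.cast_succ, Num.add_one]
  rcases (n : Num) with _ | n
  · rfl
  · exact encodePosNum_succ n

theorem encodeNat_bit1 (n : ℕ) : encodeNat (2 * n + 1) = true :: encodeNat n := by
  unfold encodeNat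
  have h : ((2 * n + 1 : ℕ) : Num) = Num.bit1 (n : Num) := by
    rw [← Num.bit1_of_bit1]
    push_cast
    ring
  rw [h]
  rcases (n : Num) with _ | n <;> rfl

theorem length_incBits_le (l : List Bool) : (incBits l).length ≤ l.length + 1 := by
  induction l with
  | nil => simp [incBits]
  | cons b l ih => cases b <;> simp [incBits]; omega

theorem length_encodeNat_le (n : ℕ) : (encodeNat n).length ≤ n := by
  induction n with
  | zero => exact le_rfl
  | succ n ih =>
    rw [encodeNat_succ]
    have := length_incBits_le (encodeNat n)
    omega

theorem sz_bits_le (l : List Bool) : sz l ≤ 4 * l.length + 1 := by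
  induction l with
  | nil => simp
  | cons b l ih =>
    have := sz_bool_le b
    rw [sz_cons, List.length_cons]
    omega

/-- A crude linear bound, sufficient for counters that do not exceed the length of a list. -/
theorem sz_nat_le (n : ℕ) : sz n ≤ 4 * n + 1 := by
  have h₁ := sz_bits_le (encodeNat n)
  have h₂ := length_encodeNat_le n
  have h₃ : sz n = sz (encodeNat n) := rfl
  omega

/-- Words of digits without superfluous zeros. -/
def canonical (l : List Bool) : Bool := l.reverse.headD true

/-- The last digit is the most significant one. If it is `true`, the decoder takes it as the leading
one and loses no digit. -/
theorem encodePosNum_decodePosNum (l : List Bool) (hl : l ≠ []) (h : canonical l = true) :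
    encodePosNum (decodePosNum l) = l := by
  induction l with
  | nil => exact absurd rfl hl
  | cons b l ih =>
    by_cases hl' : l = []
    · subst hl'
      cases b
      · simp [canonical] at h
      · rfl
    · have h' : canonical l = true := by
        rw [← h]
        unfold canonical
        rw [List.reverse_cons]
        cases hr : l.reverse with
        | nil => exact absurd (List.reverse_eq_nil_iff.1 hr) hl'
        | cons x r => rfl
      cases b <;> simp [decodePosNum, encodePosNum, hl', ih hl' h']

theorem encodeNat_decodeNat (l : List Bool) (h : canonical l = true) :
    encodeNat (decodeNat l) = l := by
  unfold encodeNat decodeNat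
  rw [Num.of_to_nat]
  by_cases hl : l = []
  · subst hl; rfl
  · rw [decodeNum, if_neg hl, PosNum.cast_to_num]
    exact encodePosNum_decodePosNum l hl h

theorem canonical_encodePosNum (n : PosNum) : canonical (encodePosNum n) = true := by
  induction n with
  | one => rfl
  | bit1 n ih | bit0 n ih =>
    unfold canonical at ih ⊢
    rw [encodePosNum, List.reverse_cons]
    cases hr : (encodePosNum n).reverse with
    | nil => exact absurd (List.reverse_eq_nil_iff.1 hr) (encodePosNum_nonempty n)
    | cons x r => simpa [hr] using ih

theorem canonical_encodeNat (n : ℕ) : canonical (encodeNat n) = true := by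
  unfold encodeNat
  rcases (n : Num) with _ | n
  · rfl
  · exact canonical_encodePosNum n

/-- The number with the given binary digits, or zero if they are not canonical. -/
def natOfBits (l : List Bool) : ℕ := bif canonical l then decodeNat l else 0

theorem natOfBits_encodeNat (n : ℕ) : natOfBits (encodeNat n) = n := by
  rw [natOfBits, canonical_encodeNat, cond_true, decode_encodeNat]

/-- The sign bit and the digits of an integer. -/
def intBits (z : ℤ) : List Bool := decide (z < 0) :: encodeNat z.natAbs

theorem encInt_eq (z : ℤ) : encInt z = (intBits z).map Γ'.bit := rfl

/-- The integer with the given sign bit and binary digits. -/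
def intOfBits (l : List Bool) : ℤ :=
  bif l.headD false then -(natOfBits l.tail : ℤ) else natOfBits l.tail

theorem intOfBits_intBits (z : ℤ) : intOfBits (intBits z) = z := by
  unfold intOfBits intBits
  simp only [List.headD_cons, List.tail_cons, natOfBits_encodeNat]
  by_cases h : z < 0
  · simp only [h, decide_true, cond_true]; omega
  · simp only [h, decide_false, cond_false]; omega

/-! ### Polynomial-time arithmetic and encoding -/

namespace PolyTime

open Polynomial

variable {α β γ σ : Type} [Enc α] [Enc β] [Enc γ] [Enc σ]

/-- A fragment only sees codes, so functions whose values have equal codes share their fragments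
even across types. -/
theorem congr_enc {f : α → β} {g : α → γ} (hg : PolyTime g) (h : ∀ a, enc (f a) = enc (g a)) :
    PolyTime f := by
  obtain ⟨F, p, hF⟩ := hg
  refine ⟨F, p, fun a => ?_⟩
  have := hF a
  rw [h a]
  rwa [show sz (g a) = sz (f a) by rw [sz, sz, h a]] at this

theorem encodeNat : PolyTime encodeNat := of_enc_eq fun _ => rfl

theorem odd : PolyTime fun n : ℕ => 2 * n + 1 :=
  congr_enc ((const true).cons encodeNat) fun n => congrArg enc (encodeNat_bit1 n)

theorem xor {f g : σ → Bool} (hf : PolyTime f) (hg : PolyTime g) :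
    PolyTime fun s => Bool.xor (f s) (g s) := by
  convert hf.cond hg.not hg using 2 with s
  cases f s <;> cases g s <;> rfl

/-- Ripple carry as a fold: the accumulator holds the carry and the digits written so far, reversed.
A carry that survives becomes the new leading digit. -/
theorem incBits : PolyTime incBits := by
  let f : List Bool × (Bool × List Bool) × Bool → Bool × List Bool := fun q =>
    (q.2.1.1 && q.2.2, Bool.xor q.2.1.1 q.2.2 :: q.2.1.2)
  have hf : PolyTime f :=
    ((fst.comp (fst.comp snd)).and (snd.comp snd)).pair
      (((fst.comp (fst.comp snd)).xor (snd.comp snd)).cons (snd.comp (fst.comp snd)))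
  have h := foldl_of_growth (id (α := List Bool)) (const (true, ([] : List Bool))) hf ?_
  · have h' := (fst.comp h).cond ((snd.comp h).reverse.append (const [true]))
      (snd.comp h).reverse
    convert h' using 2 with l
    have key₀ : ∀ (s l r : List Bool), l.foldl (fun b a => f (s, b, a)) (false, r) =
        (false, l.reverse ++ r) := by
      intro s l
      induction l with
      | nil => simp
      | cons b l ih => intro r; simp [f, ← ih]
    have key₁ : ∀ s l r : List Bool, r.reverse ++ Rikudo.incBits l =
        bif (l.foldl (fun b a => f (s, b, a)) (true, r)).1 then
          (l.foldl (fun b a => f (s, b, a)) (true, r)).2.reverse ++ [true] else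
          (l.foldl (fun b a => f (s, b, a)) (true, r)).2.reverse := by
      intro s l
      induction l with
      | nil => simp [Rikudo.incBits]
      | cons b l ih =>
        intro r
        cases b
        · rw [List.foldl_cons, show f (s, (true, r), false) = (false, true :: r) from rfl, key₀]
          simp [Rikudo.incBits]
        · rw [List.foldl_cons, show f (s, (true, r), true) = (true, false :: r) from rfl, ← ih]
          simp [Rikudo.incBits]
    exact key₁ l l []
  · refine ⟨C 10, fun s b a _ => ?_⟩
    obtain ⟨c, l⟩ := b
    have h₁ := sz_bool_le (c && a)
    have h₂ := sz_bool_le (Bool.xor c a)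
    simp only [f, eval_C]
    rw [sz_pair, sz_pair, sz_cons]
    omega

theorem succ : PolyTime fun n : ℕ => n + 1 :=
  congr_enc (incBits.comp encodeNat) fun n => congrArg enc (encodeNat_succ n)

theorem range_length {l : σ → List α} (hl : PolyTime l) :
    PolyTime fun s => List.range (l s).length := by
  have key : ∀ (l : List α), l.foldl (fun (b : ℕ × List ℕ) _ => (b.1 + 1, b.1 :: b.2)) (0, []) =
      (l.length, (List.range l.length).reverse) := by
    intro l
    induction l using List.reverseRecOn with
    | nil => rfl
    | append_singleton l a ih =>
      rw [List.foldl_append, ih]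
      simp [List.range_succ]
  have hsz : ∀ n, sz (List.range n).reverse ≤ 4 * n * n + 2 * n + 1 := by
    intro n
    induction n with
    | zero => simp
    | succ n ih =>
      rw [List.range_succ, List.reverse_append, List.reverse_singleton, List.singleton_append,
        sz_cons]
      have := sz_nat_le n
      nlinarith
  -- A step adds the size of the counter, which for an arbitrary accumulator is not bounded in terms
  -- of `s`. So the partial folds are bounded directly, by a quadratic polynomial.
  have h := foldl (f := fun q : σ × (ℕ × List ℕ) × α => (q.2.1.1 + 1, q.2.1.1 :: q.2.1.2)) hl
    (const (0, [])) ((succ.comp (fst.comp (fst.comp snd))).pair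
      ((fst.comp (fst.comp snd)).cons (snd.comp (fst.comp snd)))) ?_
  · convert (snd.comp h).reverse using 2 with s
    rw [key]
    simp
  · obtain ⟨p, hp⟩ := hl.size_le
    refine ⟨4 * p * p + 6 * p + 3, fun s l₁ l₂ h => ?_⟩
    simp only [key]
    have h₁ : l₁.length ≤ p.eval (sz s) := by
      have h₄ := length_lt_sz (l s)
      have h₅ := congrArg List.length h
      have h₆ := hp s
      rw [List.length_append] at h₅
      omega
    have h₂ := sz_nat_le l₁.length
    have h₃ := hsz l₁.length
    simp only [eval_add, eval_mul, eval_ofNat]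
    rw [sz_pair]
    nlinarith [Nat.mul_le_mul h₁ h₁]

theorem canonical : PolyTime canonical := (headD true).comp id.reverse

/-- A number is coded by its digits, so canonical digits already are the code of their value. -/
theorem natOfBits : PolyTime natOfBits := by
  refine congr_enc (canonical.cond id (const [])) fun l => ?_
  rw [Rikudo.natOfBits]
  change enc (Computability.encodeNat _) = _
  cases h : Rikudo.canonical l
  · rfl
  · rw [cond_true, cond_true, encodeNat_decodeNat l h]

theorem isNeg : PolyTime fun z : ℤ => decide (z < 0) :=
  fst.comp (of_enc_eq (f := fun z : ℤ => (decide (z < 0), z.natAbs)) fun _ => rfl)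

theorem natAbs : PolyTime Int.natAbs :=
  snd.comp (of_enc_eq (f := fun z : ℤ => (decide (z < 0), z.natAbs)) fun _ => rfl)

theorem intOfBits : PolyTime intOfBits := by
  have h := natOfBits.comp (tail (α := Bool))
  -- The comparison with zero turns a negative zero into zero.
  refine congr_enc (((headD false).and (h.decide_eq (const 0)).not).pair h) fun l => ?_
  change enc (decide (Rikudo.intOfBits l < 0), (Rikudo.intOfBits l).natAbs) = _
  congr 1
  unfold Rikudo.intOfBits
  cases l.headD false
  · simp
  · rw [cond_true]
    refine Prod.ext ?_ (by simp)
    rw [Bool.eq_iff_iff]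
    simp
    omega

theorem sym_bit {f : σ → Bool} (hf : PolyTime f) : PolyTime fun s => Γ'.bit (f s) :=
  (of_finite Γ'.bit).comp hf

theorem encNat : PolyTime encNat := encodeNat.map (sym_bit snd)

theorem encInt : PolyTime encInt := (sym_bit isNeg).cons (encNat.comp natAbs)

theorem encCell : PolyTime encCell :=
  (encInt.comp fst).append ((const Γ'.comma).cons (encInt.comp snd))

theorem encList {e : α → List Γ'} (he : PolyTime e) : PolyTime (encList e) :=
  id.flatMap (((const Γ'.bra).cons (he.comp snd)).append (const [Γ'.ket]))

end PolyTime

/-- The lists of cells, placed numbers and adjacencies of a game. -/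
abbrev Data := List Cell × List (Cell × ℕ) × List (Cell × Cell)

theorem PolyTime.encLists : PolyTime fun x : Data => encLists x.1 x.2.1 x.2.2 :=
  (((PolyTime.encList encCell).comp fst).append ((const Γ'.comma).cons
    ((PolyTime.encList ((encCell.comp fst).append ((const Γ'.comma).cons
      (encNat.comp snd)))).comp (fst.comp snd)))).append ((const Γ'.comma).cons
    ((PolyTime.encList ((encCell.comp fst).append ((const Γ'.comma).cons
      (encCell.comp snd)))).comp (snd.comp snd)))

/-! ### Parsing -/

/-- The state of the parser, which reads from right to left: whether it is inside brackets, the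
comma-separated fields of the current entry, and the lists of entries read so far. -/
abbrev ParseState := Bool × List (List Bool) × List (List (List (List Bool)))

/-- One step of the parser. -/
def parseStep (s : Γ') (x : ParseState) : ParseState :=
  match s with
  | .blank => x
  | .bit b => (x.1, (b :: x.2.1.headD []) :: x.2.1.tail, x.2.2)
  | .bra => (false, [], (x.2.1 :: x.2.2.headD []) :: x.2.2.tail)
  | .ket => (true, [[]], x.2.2)
  | .comma => bif x.1 then (true, [] :: x.2.1, x.2.2) else (false, x.2.1, [] :: x.2.2)

/-- Read a word. -/
def parseWord (w : List Γ') : ParseState := w.foldr parseStep (false, [], [[]])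

/-- The cell with the given fields. -/
def cellOfFields (l : List (List Bool)) : Cell :=
  (intOfBits (l.headD []), intOfBits (l.tail.headD []))

/-- The lists described by a word, if there are any. -/
def parse (w : List Γ') : Data :=
  let x := (parseWord w).2.2
  ((x.headD []).map cellOfFields,
    (x.tail.headD []).map (fun l => (cellOfFields l, natOfBits (l.tail.tail.headD []))),
    (x.tail.tail.headD []).map fun l => (cellOfFields l, cellOfFields l.tail.tail))

theorem foldr_parseStep_bits (l : List Bool) (b : Bool) (h : List Bool) (t : List (List Bool))
    (x : List (List (List (List Bool)))) :
    (l.map Γ'.bit).foldr parseStep (b, h :: t, x) = (b, (l ++ h) :: t, x) := by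
  induction l with
  | nil => rfl
  | cons c l ih => simp [ih, parseStep]

theorem parseStep_comma (t : List (List Bool)) (x : List (List (List (List Bool)))) :
    parseStep .comma (true, t, x) = (true, [] :: t, x) := rfl

theorem foldr_parseStep_cell (c : Cell) (t : List (List Bool))
    (x : List (List (List (List Bool)))) :
    (encCell c).foldr parseStep (true, [] :: t, x) =
      (true, intBits c.1 :: intBits c.2 :: t, x) := by
  simp [encCell, encInt_eq, foldr_parseStep_bits, parseStep_comma]

/-- Read from the right, `ket` opens an entry with one empty field and `bra` files it in the current
list; `d` gives the fields of an entry. -/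
theorem foldr_parseStep_encList {α : Type} (e : α → List Γ') (d : α → List (List Bool))
    (he : ∀ a x, (e a).foldr parseStep (true, [[]], x) = (true, d a, x))
    (l : List α) (h : List (List (List Bool))) (x : List (List (List (List Bool)))) :
    (encList e l).foldr parseStep (false, [], h :: x) = (false, [], (l.map d ++ h) :: x) := by
  induction l with
  | nil => rfl
  | cons a l ih =>
    rw [encList, List.flatMap_cons, List.foldr_append]
    rw [encList] at ih
    rw [ih, List.cons_append, List.foldr_cons, List.foldr_append, List.foldr_cons, List.foldr_nil,
      show parseStep .ket (false, [], (l.map d ++ h) :: x) = (true, [[]], (l.map d ++ h) :: x)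
        from rfl, he]
    rfl

/-- A left inverse is enough: on other words the parser may return anything, since the result is
encoded again and compared. -/
theorem parse_encLists (x : Data) : parse (encLists x.1 x.2.1 x.2.2) = x := by
  obtain ⟨cells, placed, links⟩ := x
  have h : parseWord (encLists cells placed links) = (false, [],
      [cells.map fun c => [intBits c.1, intBits c.2],
        placed.map fun e => [intBits e.1.1, intBits e.1.2, encodeNat e.2],
        links.map fun e => [intBits e.1.1, intBits e.1.2, intBits e.2.1, intBits e.2.2]]) := by
    have e₁ := foldr_parseStep_encList encCell (fun c => [intBits c.1, intBits c.2])
      fun c x => foldr_parseStep_cell c [] x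
    have e₂ := foldr_parseStep_encList
      (fun e : Cell × ℕ => encCell e.1 ++ Γ'.comma :: encNat e.2)
      (fun e => [intBits e.1.1, intBits e.1.2, encodeNat e.2]) fun e x => by
        simp [encNat, foldr_parseStep_bits, parseStep_comma, foldr_parseStep_cell]
    have e₃ := foldr_parseStep_encList
      (fun e : Cell × Cell => encCell e.1 ++ Γ'.comma :: encCell e.2)
      (fun e => [intBits e.1.1, intBits e.1.2, intBits e.2.1, intBits e.2.2]) fun e x => by
        simp [parseStep_comma, foldr_parseStep_cell]
    have e₄ : ∀ x, parseStep .comma (false, [], x) = (false, [], [] :: x) := fun _ => rfl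
    unfold parseWord encLists
    simp [e₁, e₂, e₃, e₄]
  simp only [parse, h]
  simp [cellOfFields, intOfBits_intBits, natOfBits_encodeNat, Function.comp_def]

/-! ### The parser in polynomial time -/

namespace PolyTime

open Polynomial

theorem parseWord : PolyTime parseWord := by
  have hf : PolyTime fun q : List Γ' × ParseState × Γ' => parseStep q.2.2 q.2.1 := by
    have h₀ : PolyTime fun q : List Γ' × ParseState × Γ' => q.2.1 := fst.comp snd
    have h₁ := fst.comp h₀
    have h₂ := fst.comp (snd.comp h₀)
    have h₃ := snd.comp (snd.comp h₀)
    refine finite_cases (f := fun s (q : List Γ' × ParseState × Γ') => parseStep s q.2.1)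
      (snd.comp snd) fun s => ?_
    rcases s with _ | b | _ | _ | _
    · exact h₀
    · exact h₁.pair ((((const b).cons ((headD []).comp h₂)).cons (tail.comp h₂)).pair h₃)
    · exact (const false).pair ((const []).pair
        ((h₂.cons ((headD []).comp h₃)).cons (tail.comp h₃)))
    · exact (const true).pair ((const [[]]).pair h₃)
    · exact h₁.cond ((const true).pair (((const []).cons h₂).pair h₃))
        ((const false).pair (h₂.pair ((const []).cons h₃)))
  have h := foldl_of_growth (id (α := List Γ')).reverse (const (false, [], [[]])) hf ?_
  · convert h using 2 with w
    rw [List.foldl_reverse]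
    rfl
  · refine ⟨C 20, fun w x s _ => ?_⟩
    obtain ⟨b, t, l⟩ := x
    have hb := sz_pos b
    have ht := sz_pos t
    simp only [eval_C]
    have h₁ : sz true = 3 := rfl
    have h₂ : sz false = 1 := rfl
    rcases s with _ | c | _ | _ | _
    · simp [parseStep]
    · have hc := sz_bool_le c
      rcases t with _ | ⟨f, t⟩ <;> simp [parseStep, sz_pair, sz_cons] <;> omega
    · rcases l with _ | ⟨f, l⟩ <;> simp [parseStep, sz_pair, sz_cons] <;> omega
    · simp [parseStep, sz_pair, sz_cons]; omega
    · cases b <;> simp [parseStep, sz_pair, sz_cons] <;> omega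

theorem cellOfFields {σ : Type} [Enc σ] {f : σ → List (List Bool)} (hf : PolyTime f) :
    PolyTime fun s => cellOfFields (f s) :=
  (intOfBits.comp ((headD []).comp hf)).pair (intOfBits.comp ((headD []).comp (tail.comp hf)))

theorem parse : PolyTime parse := by
  have h : PolyTime fun w => (Rikudo.parseWord w).2.2 := snd.comp (snd.comp parseWord)
  exact (((headD []).comp h).map (cellOfFields snd)).pair
    ((((headD []).comp (tail.comp h)).map ((cellOfFields snd).pair
      (natOfBits.comp ((headD []).comp (tail.comp (tail.comp snd)))))).pair
    (((headD []).comp (tail.comp (tail.comp h))).map ((cellOfFields snd).pair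
      (cellOfFields (tail.comp (tail.comp snd))))))

end PolyTime

/-! ### The algorithm -/

section Matching

variable {α : Type} [DecidableEq α]

/-- The lists `B` and `C` have a common entry. -/
def meets (C B : List α) : Bool := B.any fun a => decide (a ∈ C)

/-- One step of the greedy matching: the blocks that meet `C` are merged into one block, or
discarded if there is only one. -/
def matchStep (x : Bool × List (List α)) (C : List α) : Bool × List (List α) :=
  (x.1 && !(x.2.filter (meets C)).isEmpty,
    bif (x.2.filter (meets C)).tail.isEmpty then x.2.filter fun B => !meets C B
    else (x.2.filter (meets C)).flatten :: x.2.filter fun B => !meets C B)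

/-- Decide whether distinct representatives in `U` can be chosen from the lists `Cs`. -/
def hasMatching (U : List α) (Cs : List (List α)) : Bool :=
  (Cs.foldl matchStep (true, U.map fun u => [u])).1

end Matching

/-- Adjacency of cells. -/
def adjB (c c' : Cell) : Bool :=
  (decide (c'.1 = c.1 + 1) && decide (c.2 = c'.2)) ||
  ((decide (c.1 = c'.1 + 1) && decide (c.2 = c'.2)) ||
  ((decide (c.1 = c'.1) && decide (c'.2 = c.2 + 1)) ||
  ((decide (c.1 = c'.1) && decide (c.2 = c'.2 + 1)) ||
  ((decide (c'.1 = c.1 + 1) && decide (c.2 = c'.2 + 1)) ||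
  (decide (c.1 = c'.1 + 1) && decide (c'.2 = c.2 + 1))))))

theorem adjB_iff (c c' : Cell) : adjB c c' = true ↔ hexGrid.Adj c c' := by
  simp only [adjB, hexGrid, Set.mem_insert_iff, Set.mem_singleton_iff, Prod.mk.injEq,
    Bool.or_eq_true, Bool.and_eq_true, decide_eq_true_eq]
  omega

/-- The cells that carry a number. -/
def placedCells (x : Data) : List Cell := x.2.1.map fun e => e.1

/-- The cells without a number. -/
def freeCells (x : Data) : List Cell := x.1.filter fun c => !decide (c ∈ placedCells x)

/-- The cells with the numbers `2 * i + 1` and `2 * i + 3`. -/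
def slot (x : Data) (i : ℕ) : List Cell :=
  (x.2.1.filter fun e => decide (e.2 = 2 * i + 1) || decide (e.2 = 2 * (i + 1) + 1)).map
    fun e => e.1

/-- The cells that may carry the number `2 * i + 2`. -/
def candidates (x : Data) (i : ℕ) : List Cell :=
  (freeCells x).filter fun u => (slot x i).all (fun c => adjB c u) &&
    x.2.2.all fun e => (!decide (e.1 = u) || decide (e.2 ∈ slot x i)) &&
      (!decide (e.2 = u) || decide (e.1 ∈ slot x i))

/-- The lists describe a game with the odd numbers placed. -/
def wellFormed (x : Data) : Bool :=
  !x.1.isEmpty && (decide x.1.Nodup && (decide x.2.2.Nodup && (decide (placedCells x).Nodup &&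
  ((placedCells x).all (fun c => decide (c ∈ x.1)) &&
  ((List.range x.2.1.length).all (fun i => x.2.1.any fun e => decide (e.2 = 2 * i + 1)) &&
  ((decide ((freeCells x).length = x.2.1.length) ||
    decide ((freeCells x).length + 1 = x.2.1.length)) &&
  x.2.2.all (fun e => decide (e.1 ∈ x.1) && (decide (e.2 ∈ x.1) && adjB e.1 e.2))))))))

/-- The lists describe a solvable game with the odd numbers placed. -/
def check (x : Data) : Bool :=
  wellFormed x &&
  (x.2.2.all (fun e => !(decide (e.1 ∈ placedCells x) && decide (e.2 ∈ placedCells x))) &&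
  hasMatching (freeCells x) ((List.range (freeCells x).length).map (candidates x)))

/-- The decision procedure. -/
def decideWord (w : List Γ') : Bool :=
  decide (encLists (parse w).1 (parse w).2.1 (parse w).2.2 = w) && check (parse w)

/-- Together with `sz_flatten_le`, this shows that a matching step rearranges blocks without
duplication, so the state grows by a constant. -/
theorem sz_filter_add_sz_filter_not {α : Type} [Enc α] (p : α → Bool) (l : List α) :
    sz (l.filter p) + sz (l.filter fun a => !p a) = sz l + 1 := by
  induction l with
  | nil => simp
  | cons a l ih => cases h : p a <;> simp [h, sz_cons] <;> omega

theorem sz_flatten_le {α : Type} [Enc α] (l : List (List α)) : sz l.flatten ≤ sz l := by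
  induction l with
  | nil => simp
  | cons a l ih =>
    have := sz_append a l.flatten
    rw [List.flatten_cons, sz_cons]
    omega

/-! ### The decision procedure in polynomial time -/

namespace PolyTime

open Polynomial

variable {α σ : Type} [Enc α] [Enc σ]

theorem meets [DecidableEq α] {f g : σ → List α} (hf : PolyTime f) (hg : PolyTime g) :
    PolyTime fun s => meets (f s) (g s) :=
  hg.any ((hf.comp fst).mem snd)

theorem matchStep [DecidableEq α] {f : σ → Bool × List (List α)} {g : σ → List α}
    (hf : PolyTime f) (hg : PolyTime g) : PolyTime fun s => matchStep (f s) (g s) := by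
  have h₁ := (snd.comp hf).filter (meets (hg.comp fst) snd)
  have h₂ := (snd.comp hf).filter (meets (hg.comp fst) snd).not
  exact ((fst.comp hf).and h₁.isEmpty.not).pair
    ((tail.comp h₁).isEmpty.cond h₂ (h₁.flatten.cons h₂))

theorem hasMatching [DecidableEq α] {f : σ → List α} {g : σ → List (List α)}
    (hf : PolyTime f) (hg : PolyTime g) : PolyTime fun s => hasMatching (f s) (g s) := by
  refine fst.comp (foldl_of_growth
    (f := fun q : σ × (Bool × List (List α)) × List α => Rikudo.matchStep q.2.1 q.2.2) hg
    ((const true).pair (hf.map (snd.cons (const [])))) (matchStep (fst.comp snd) (snd.comp snd))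
    ⟨C 10, fun s x C _ => ?_⟩)
  obtain ⟨b, l⟩ := x
  simp only [Rikudo.matchStep, eval_C]
  have h₁ := sz_filter_add_sz_filter_not (Rikudo.meets C) l
  have h₂ := sz_flatten_le (l.filter (Rikudo.meets C))
  have h₃ := sz_bool_le (b && !(l.filter (Rikudo.meets C)).isEmpty)
  rw [sz_pair, sz_pair]
  cases (List.filter (Rikudo.meets C) l).tail.isEmpty
  · rw [cond_false, sz_cons]; omega
  · rw [cond_true]; omega

theorem eq_add_one {f g : σ → ℤ} (hf : PolyTime f) (hg : PolyTime g) :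
    PolyTime fun s => decide (g s = f s + 1) := by
  have h₁ := natAbs.comp hf
  have h₂ := natAbs.comp hg
  -- On negative integers the successor lowers the absolute value, so signs and the successor of
  -- natural numbers suffice.
  convert (isNeg.comp hf).cond
    (((isNeg.comp hg).or (h₂.decide_eq (const 0))).and (h₁.decide_eq (succ.comp h₂)))
    ((isNeg.comp hg).not.and (h₂.decide_eq (succ.comp h₁))) using 2 with s
  rw [Bool.eq_iff_iff]
  by_cases h : f s < 0
  · simp only [h, decide_true, cond_true, Bool.and_eq_true, Bool.or_eq_true, decide_eq_true_eq]
    omega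
  · simp only [h, decide_false, cond_false, Bool.and_eq_true, Bool.not_eq_true',
      decide_eq_true_eq, decide_eq_false_iff_not]
    omega

theorem adjB {f g : σ → Cell} (hf : PolyTime f) (hg : PolyTime g) :
    PolyTime fun s => adjB (f s) (g s) := by
  have f₁ := fst.comp hf
  have f₂ := snd.comp hf
  have g₁ := fst.comp hg
  have g₂ := snd.comp hg
  exact ((eq_add_one f₁ g₁).and (f₂.decide_eq g₂)).or
    (((eq_add_one g₁ f₁).and (f₂.decide_eq g₂)).or
    (((f₁.decide_eq g₁).and (eq_add_one f₂ g₂)).or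
    (((f₁.decide_eq g₁).and (eq_add_one g₂ f₂)).or
    (((eq_add_one f₁ g₁).and (eq_add_one g₂ f₂)).or
    ((eq_add_one g₁ f₁).and (eq_add_one f₂ g₂))))))

theorem length {l : σ → List α} (hl : PolyTime l) : PolyTime fun s => (l s).length := by
  -- The length is the last entry of a range that is one longer; the additional `false` provides
  -- that entry.
  have h := (headD 0).comp
    (((const false).cons (hl.map (f := fun _ => false) (const false))).range_length.reverse)
  convert h using 2 with s
  simp [List.range_succ]

theorem placedCells {f : σ → Data} (hf : PolyTime f) : PolyTime fun s => placedCells (f s) :=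
  (fst.comp (snd.comp hf)).map (fst.comp snd)

theorem freeCells {f : σ → Data} (hf : PolyTime f) : PolyTime fun s => freeCells (f s) :=
  (fst.comp hf).filter (mem (placedCells (hf.comp fst)) snd).not

theorem slot {f : σ → Data} {g : σ → ℕ} (hf : PolyTime f) (hg : PolyTime g) :
    PolyTime fun s => slot (f s) (g s) :=
  ((fst.comp (snd.comp hf)).filter (((snd.comp snd).decide_eq (odd.comp (hg.comp fst))).or
    ((snd.comp snd).decide_eq (odd.comp (succ.comp (hg.comp fst)))))).map (fst.comp snd)

theorem candidates {f : σ → Data} {g : σ → ℕ} (hf : PolyTime f) (hg : PolyTime g) :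
    PolyTime fun s => candidates (f s) (g s) := by
  have h := slot hf hg
  have h' := (h.comp fst).comp (fst (α := σ × Cell) (β := Cell × Cell))
  have h₁ : PolyTime fun q : (σ × Cell) × (Cell × Cell) =>
      (!decide (q.2.1 = q.1.2) || decide (q.2.2 ∈ Rikudo.slot (f q.1.1) (g q.1.1))) &&
      (!decide (q.2.2 = q.1.2) || decide (q.2.1 ∈ Rikudo.slot (f q.1.1) (g q.1.1))) :=
    (((fst.comp snd).decide_eq (snd.comp fst)).not.or (h'.mem (snd.comp snd))).and
      (((snd.comp snd).decide_eq (snd.comp fst)).not.or (h'.mem (fst.comp snd)))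
  exact (freeCells hf).filter (((h.comp fst).all (adjB snd (snd.comp fst))).and
    ((snd.comp (snd.comp (hf.comp fst))).all h₁))

theorem wellFormed : PolyTime wellFormed := by
  have h₁ : PolyTime fun x : Data => x.1 := fst
  have h₂ : PolyTime fun x : Data => x.2.1 := fst.comp snd
  have h₃ : PolyTime fun x : Data => x.2.2 := snd.comp snd
  have hp := placedCells (id (α := Data))
  have hu := freeCells (id (α := Data))
  exact h₁.isEmpty.not.and (h₁.nodup.and (h₃.nodup.and (hp.nodup.and
    ((hp.all ((h₁.comp fst).mem snd)).and
    ((h₂.range_length.all ((h₂.comp fst).any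
      ((snd.comp snd).decide_eq (odd.comp (snd.comp fst))))).and
    (((hu.length.decide_eq h₂.length).or ((succ.comp hu.length).decide_eq h₂.length)).and
    (h₃.all (((h₁.comp fst).mem (fst.comp snd)).and (((h₁.comp fst).mem (snd.comp snd)).and
      (adjB (fst.comp snd) (snd.comp snd)))))))))))

theorem check : PolyTime check := by
  have h₃ : PolyTime fun x : Data => x.2.2 := snd.comp snd
  have hp := placedCells (id (α := Data))
  have hu := freeCells (id (α := Data))
  exact wellFormed.and ((h₃.all (((hp.comp fst).mem (fst.comp snd)).and
    ((hp.comp fst).mem (snd.comp snd))).not).and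
    (hasMatching hu (hu.range_length.map (candidates fst snd))))

theorem decideWord : PolyTime decideWord :=
  ((encLists.comp parse).decide_eq id).and (check.comp parse)

end PolyTime

/-! ### Correctness of the matching algorithm -/

section Matching

variable {α : Type}

/-- The blocks are nonempty and disjoint. -/
def Separated (blocks : List (List α)) : Prop :=
  blocks.Pairwise List.Disjoint ∧ ∀ B ∈ blocks, B ≠ []

theorem Separated.filter {blocks : List (List α)} (h : Separated blocks) (p : List α → Bool) :
    Separated (blocks.filter p) :=
  ⟨h.1.filter _, fun B hB => h.2 B (List.mem_of_mem_filter hB)⟩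

theorem Separated.eq_of_mem {blocks : List (List α)} (h : Separated blocks) {A B : List α}
    (hA : A ∈ blocks) (hB : B ∈ blocks) {a : α} (ha : a ∈ A) (hb : a ∈ B) : A = B := by
  by_contra hne
  have : Std.Symm (List.Disjoint (α := α)) := ⟨fun _ _ h => h.symm⟩
  exact h.1.forall hA hB hne ha hb

variable [DecidableEq α]

theorem meets_iff {C B : List α} : meets C B = true ↔ ∃ a ∈ B, a ∈ C := by
  simp [meets]

/-- The lists `Cs` can be matched with distinct blocks which they meet. -/
def Matchable (blocks Cs : List (List α)) : Prop :=
  ∃ Bs : List (List α), Bs.Nodup ∧ (∀ B ∈ Bs, B ∈ blocks) ∧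
    List.Forall₂ (fun B C => meets C B = true) Bs Cs

/-- Three disjoint blocks meeting `C` would give three different entries of `C`. -/
theorem length_filter_meets_le {blocks : List (List α)} (h : Separated blocks) {C : List α}
    (hC : C.length ≤ 2) : (blocks.filter (meets C)).length ≤ 2 := by
  have hs := h.filter (meets C)
  have hm : ∀ B ∈ blocks.filter (meets C), ∃ a ∈ B, a ∈ C := fun B hB =>
    meets_iff.1 (List.mem_filter.1 hB).2
  rcases hM : blocks.filter (meets C) with _ | ⟨A, _ | ⟨B, _ | ⟨D, M⟩⟩⟩
  · simp
  · simp
  · simp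
  · exfalso
    rw [hM] at hs hm
    obtain ⟨a, haA, haC⟩ := hm A (by simp)
    obtain ⟨b, hbB, hbC⟩ := hm B (by simp)
    obtain ⟨d, hdD, hdC⟩ := hm D (by simp)
    have hp := hs.1
    simp only [List.pairwise_cons, List.mem_cons, forall_eq_or_imp] at hp
    have hab : a ≠ b := fun e => hp.1.1 haA (e ▸ hbB)
    have had : a ≠ d := fun e => hp.1.2.1 haA (e ▸ hdD)
    have hbd : b ≠ d := fun e => hp.2.1.1 hbB (e ▸ hdD)
    have hn : [a, b, d].Nodup := by simp [hab, had, hbd]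
    have hsub : [a, b, d] ⊆ C := by simp [haC, hbC, hdC]
    have := (hn.subperm hsub).length_le
    simp at this
    omega

/-- Without repetitions `K` has at most one partner, and this partner decides between `A` and `B`.
If `K` does not occur, either choice works. -/
theorem exists_forall₂_replace {β : Type} {r : List α → β → Prop} {Bs : List (List α)}
    {Cs : List β} (h : List.Forall₂ r Bs Cs) (hn : Bs.Nodup) {K A B : List α}
    (hK : ∀ C, r K C → r A C ∨ r B C) :
    ∃ Z, (Z = A ∨ Z = B) ∧ List.Forall₂ r (Bs.map fun X => if X = K then Z else X) Cs := by
  induction h with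
  | nil => exact ⟨A, .inl rfl, .nil⟩
  | @cons X C Bs Cs hX hBs ih =>
    rw [List.nodup_cons] at hn
    by_cases hXK : X = K
    · subst hXK
      have hid : ∀ Z, (Bs.map fun Y => if Y = X then Z else Y) = Bs := fun Z =>
        (List.map_congr_left (g := id) fun Y hY => if_neg (show Y ≠ X from
          fun e => hn.1 (e ▸ hY))).trans (List.map_id Bs)
      rcases hK C hX with h | h
      · exact ⟨A, .inl rfl, by rw [List.map_cons, if_pos rfl, hid]; exact .cons h hBs⟩
      · exact ⟨B, .inr rfl, by rw [List.map_cons, if_pos rfl, hid]; exact .cons h hBs⟩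
    · obtain ⟨Z, hZ, h⟩ := ih hn.2
      exact ⟨Z, hZ, by rw [List.map_cons, if_neg hXK]; exact .cons hX h⟩

theorem nodup_map_replace {Bs : List (List α)} (hn : Bs.Nodup) {K Z : List α} (hZ : Z ∉ Bs) :
    (Bs.map fun X => if X = K then Z else X).Nodup := by
  refine hn.map_on fun X hX Y hY e => ?_
  by_cases h₁ : X = K <;> by_cases h₂ : Y = K
  · rw [h₁, h₂]
  · rw [if_pos h₁, if_neg h₂] at e
    exact absurd (e ▸ hY) hZ
  · rw [if_neg h₁, if_pos h₂] at e
    exact absurd (e ▸ hX) hZ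
  · rwa [if_neg h₁, if_neg h₂] at e

/-- The blocks after a step of the algorithm. -/
theorem matchStep_snd (x : Bool × List (List α)) (C : List α) :
    (matchStep x C).2 = bif (x.2.filter (meets C)).tail.isEmpty then
      x.2.filter fun B => !meets C B
    else (x.2.filter (meets C)).flatten :: x.2.filter fun B => !meets C B := rfl

theorem separated_matchStep {x : Bool × List (List α)} (h : Separated x.2) (C : List α) :
    Separated (matchStep x C).2 := by
  have hR := h.filter fun B => !meets C B
  rw [matchStep_snd]
  rcases hM : x.2.filter (meets C) with _ | ⟨A, _ | ⟨B, M⟩⟩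
  · simpa using hR
  · simpa using hR
  · simp only [List.tail_cons, List.isEmpty_cons, cond_false]
    have hM' : ∀ B' ∈ A :: B :: M, B' ∈ x.2 ∧ meets C B' = true := fun B' hB' =>
      List.mem_filter.1 (hM ▸ hB')
    refine ⟨List.pairwise_cons.2 ⟨fun D hD => ?_, hR.1⟩, fun D hD => ?_⟩
    · intro a ha haD
      obtain ⟨B', hB', ha⟩ := List.mem_flatten.1 ha
      have hD' := List.mem_filter.1 hD
      have := h.eq_of_mem (hM' B' hB').1 hD'.1 ha haD
      subst this
      simp [(hM' B' hB').2] at hD'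
    · rcases List.mem_cons.1 hD with rfl | hD
      · have := h.2 A (hM' A (by simp)).1
        simp [this]
      · exact hR.2 D hD

theorem matchable_nil (blocks : List (List α)) : Matchable blocks [] :=
  ⟨[], by simp, by simp, .nil⟩

/-- No bound on the length of `C` is needed here; this takes care of the last even number. -/
theorem matchable_singleton {blocks : List (List α)} {C : List α} :
    Matchable blocks [C] ↔ blocks.filter (meets C) ≠ [] := by
  constructor
  · rintro ⟨Bs, -, hm, hf⟩ h
    obtain ⟨B, Bs, hB, _, rfl⟩ := List.forall₂_cons_right_iff.1 hf
    have : B ∈ blocks.filter (meets C) := List.mem_filter.2 ⟨hm B (by simp), hB⟩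
    simp [h] at this
  · intro h
    obtain ⟨B, hB⟩ := List.exists_mem_of_ne_nil _ h
    have hB := List.mem_filter.1 hB
    exact ⟨[B], by simp, by simpa using hB.1, .cons hB.2 .nil⟩

/-- If only one block meets `C`, then `C` must take it. If `A` and `B` do, `C` takes one of them and
the merged block stands for the other. Conversely, a list matched with `A ++ B` meets `A` or `B`; it
takes that block and leaves the other to `C`. -/
theorem matchable_cons {x : Bool × List (List α)} (h : Separated x.2) {C : List α}
    (hC : C.length ≤ 2) (Cs : List (List α)) :
    Matchable x.2 (C :: Cs) ↔
      x.2.filter (meets C) ≠ [] ∧ Matchable (matchStep x C).2 Cs := by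
  obtain ⟨b, blocks⟩ := x
  have hlen := length_filter_meets_le h hC
  have hsep := separated_matchStep (x := (b, blocks)) h C
  rw [matchStep_snd] at hsep ⊢
  simp only at h hlen hsep ⊢
  have hmem : ∀ B, B ∈ blocks.filter (meets C) ↔ B ∈ blocks ∧ meets C B = true := fun B =>
    List.mem_filter
  have hrest : ∀ B, B ∈ (blocks.filter fun B => !meets C B) ↔
      B ∈ blocks ∧ ¬meets C B = true := fun B => by simp
  rcases hM : blocks.filter (meets C) with _ | ⟨A, _ | ⟨B, _ | ⟨D, M⟩⟩⟩
  · refine ⟨?_, fun h => absurd rfl h.1⟩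
    rintro ⟨Bs, -, hm, hf⟩
    obtain ⟨B, Bs, hB, _, rfl⟩ := List.forall₂_cons_right_iff.1 hf
    have := (hmem B).2 ⟨hm B (by simp), hB⟩
    simp [hM] at this
  · rw [hM] at hmem
    simp only [List.mem_singleton] at hmem
    simp only [ne_eq, reduceCtorEq, not_false_eq_true, List.tail_cons, List.isEmpty_nil, cond_true,
      true_and]
    constructor
    · rintro ⟨Bs, hn, hm, hf⟩
      obtain ⟨B, Bs, hB, hf₀, rfl⟩ := List.forall₂_cons_right_iff.1 hf
      have hBA := (hmem B).2 ⟨hm B (by simp), hB⟩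
      subst hBA
      rw [List.nodup_cons] at hn
      refine ⟨Bs, hn.2, fun D hD => (hrest D).2 ⟨hm D (List.mem_cons_of_mem _ hD), fun hD' => ?_⟩,
        hf₀⟩
      exact hn.1 ((hmem D).2 ⟨hm D (List.mem_cons_of_mem _ hD), hD'⟩ ▸ hD)
    · rintro ⟨Bs, hn, hm, hf⟩
      have hA := (hmem A).1 rfl
      refine ⟨A :: Bs, List.nodup_cons.2 ⟨fun hA' => ((hrest A).1 (hm A hA')).2 hA.2, hn⟩,
        fun D hD => ?_, .cons hA.2 hf⟩
      rcases List.mem_cons.1 hD with rfl | hD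
      · exact hA.1
      · exact ((hrest D).1 (hm D hD)).1
  · rw [hM] at hmem hsep
    simp only [List.mem_cons, List.not_mem_nil, or_false] at hmem
    simp only [List.tail_cons, List.isEmpty_cons, cond_false, List.flatten_cons,
      List.flatten_nil, List.append_nil] at hsep
    simp only [ne_eq, reduceCtorEq, not_false_eq_true, List.tail_cons, List.isEmpty_cons,
      cond_false, true_and, List.flatten_cons, List.flatten_nil, List.append_nil]
    have hA := (hmem A).1 (.inl rfl)
    have hB := (hmem B).1 (.inr rfl)
    have hAB : A ≠ B := by
      have := (h.filter (meets C)).1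
      rw [hM] at this
      intro e
      obtain ⟨a, ha⟩ := List.exists_mem_of_ne_nil _ (h.2 A hA.1)
      exact (List.pairwise_cons.1 this).1 B (by simp) ha (e ▸ ha)
    have hne : ∀ Y, Y = A ∨ Y = B → A ++ B ≠ Y := by
      rintro Y (rfl | rfl)
      · simpa using h.2 B hB.1
      · simpa using h.2 A hA.1
    have hKR : A ++ B ∉ blocks.filter fun B => !meets C B := by
      intro hK
      obtain ⟨a, ha⟩ := List.exists_mem_of_ne_nil _ (h.2 A hA.1)
      exact (List.pairwise_cons.1 hsep.1).1 _ hK (List.mem_append_left B ha)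
        (List.mem_append_left B ha)
    constructor
    · rintro ⟨Bs, hn, hm, hf⟩
      obtain ⟨X, Bs, hX, hf₀, rfl⟩ := List.forall₂_cons_right_iff.1 hf
      rw [List.nodup_cons] at hn
      have hm' : ∀ D ∈ Bs, D ∈ blocks := fun D hD => hm D (List.mem_cons_of_mem _ hD)
      -- `Y` is the block that `C` leaves; its occurrence, if any, is renamed to the merged block.
      obtain ⟨Y, hY, hYX⟩ : ∃ Y, (Y = A ∨ Y = B) ∧ ∀ D, (D = A ∨ D = B) → D = X ∨ D = Y := by
        rcases (hmem X).2 ⟨hm X (by simp), hX⟩ with rfl | rfl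
        · exact ⟨B, .inr rfl, fun D hD => hD⟩
        · exact ⟨A, .inl rfl, fun D hD => hD.symm⟩
      have hBs : ∀ D ∈ Bs, D = Y ∨ D ∈ blocks.filter fun B => !meets C B := by
        intro D hD
        by_cases hDC : meets C D = true
        · rcases hYX D ((hmem D).2 ⟨hm' D hD, hDC⟩) with rfl | hDY
          · exact absurd hD hn.1
          · exact .inl hDY
        · exact .inr ((hrest D).2 ⟨hm' D hD, hDC⟩)
      have hYK : ∀ C', meets C' Y = true → meets C' (A ++ B) = true := by
        intro C' hC'
        obtain ⟨a, ha, haC⟩ := meets_iff.1 hC'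
        refine meets_iff.2 ⟨a, ?_, haC⟩
        rcases hY with rfl | rfl <;> simp [ha]
      have hK : A ++ B ∉ Bs := fun hK => (hBs _ hK).elim (hne Y hY) hKR
      obtain ⟨Z, hZ, hf'⟩ := exists_forall₂_replace (K := Y) (A := A ++ B) (B := A ++ B) hf₀ hn.2
        fun C' hC' => .inl (hYK C' hC')
      obtain rfl : Z = A ++ B := hZ.elim (fun h => h) (fun h => h)
      refine ⟨_, nodup_map_replace hn.2 hK, fun D hD => ?_, hf'⟩
      obtain ⟨D', hD', rfl⟩ := List.mem_map.1 hD
      by_cases hDY : D' = Y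
      · rw [if_pos hDY]; simp
      · rw [if_neg hDY]
        exact List.mem_cons_of_mem _ ((hBs D' hD').resolve_left hDY)
    · rintro ⟨Bs, hn, hm, hf⟩
      obtain ⟨Z, hZ, hf'⟩ := exists_forall₂_replace (K := A ++ B) (A := A) (B := B) hf hn
        fun C' hC' => by
          obtain ⟨a, ha, haC⟩ := meets_iff.1 hC'
          rcases List.mem_append.1 ha with ha | ha
          · exact .inl (meets_iff.2 ⟨a, ha, haC⟩)
          · exact .inr (meets_iff.2 ⟨a, ha, haC⟩)
      -- `Z` replaces the merged block, and `X` is the half that remains for `C`.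
      obtain ⟨X, hX, hXZ⟩ : ∃ X, (X = A ∨ X = B) ∧ X ≠ Z := by
        rcases hZ with rfl | rfl
        · exact ⟨B, .inr rfl, hAB.symm⟩
        · exact ⟨A, .inl rfl, hAB⟩
      have hX' := (hmem X).1 hX
      have hZ' := (hmem Z).1 hZ
      have key : ∀ D ∈ Bs, D ≠ A ++ B → D ∈ blocks ∧ ¬meets C D = true := fun D hD hDK =>
        (hrest D).1 ((List.mem_cons.1 (hm D hD)).resolve_left hDK)
      have hZB : Z ∉ Bs := fun hZB => (key Z hZB (hne Z hZ).symm).2 hZ'.2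
      refine ⟨X :: _, List.nodup_cons.2 ⟨fun hXB => ?_, nodup_map_replace hn hZB⟩,
        fun D hD => ?_, .cons hX'.2 hf'⟩
      · obtain ⟨D', hD', hDX⟩ := List.mem_map.1 hXB
        by_cases hDK : D' = A ++ B
        · rw [if_pos hDK] at hDX
          exact hXZ hDX.symm
        · rw [if_neg hDK] at hDX
          exact (key D' hD' hDK).2 (hDX ▸ hX'.2)
      · rcases List.mem_cons.1 hD with rfl | hD
        · exact hX'.1
        · obtain ⟨D', hD', rfl⟩ := List.mem_map.1 hD
          by_cases hDK : D' = A ++ B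
          · rw [if_pos hDK]; exact hZ'.1
          · rw [if_neg hDK]; exact (key D' hD' hDK).1
  · rw [hM] at hlen
    simp at hlen

theorem foldl_matchStep {Cs : List (List α)} : (∀ C ∈ Cs.dropLast, C.length ≤ 2) →
    ∀ x : Bool × List (List α), Separated x.2 →
      ((Cs.foldl matchStep x).1 = true ↔ x.1 = true ∧ Matchable x.2 Cs) := by
  induction Cs with
  | nil => simp [matchable_nil]
  | cons C Cs ih =>
    intro hC x hx
    have h₁ : (matchStep x C).1 = true ↔ x.1 = true ∧ x.2.filter (meets C) ≠ [] := by
      simp [matchStep, List.isEmpty_eq_false_iff]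
    rw [List.foldl_cons]
    rcases Cs with _ | ⟨C', Cs⟩
    · rw [List.foldl_nil, h₁, matchable_singleton]
    · rw [List.dropLast_cons_of_ne_nil (by simp)] at hC
      rw [ih (fun D hD => hC D (List.mem_cons_of_mem _ hD)) _ (separated_matchStep hx C), h₁,
        matchable_cons hx (hC C (by simp)), and_assoc]

theorem hasMatching_iff {U : List α} (hU : U.Nodup) {Cs : List (List α)}
    (hCs : ∀ C ∈ Cs.dropLast, C.length ≤ 2) :
    hasMatching U Cs = true ↔
      ∃ R : List α, R.Nodup ∧ (∀ r ∈ R, r ∈ U) ∧ List.Forall₂ (· ∈ ·) R Cs := by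
  have hs : Separated (U.map fun u => [u]) := by
    refine ⟨List.pairwise_map.2 (hU.imp fun h => by simpa using Ne.symm h), fun B hB => ?_⟩
    obtain ⟨u, -, rfl⟩ := List.mem_map.1 hB
    simp
  rw [hasMatching, foldl_matchStep hCs _ hs]
  simp only [true_and]
  constructor
  · rintro ⟨Bs, hn, hm, hf⟩
    have hr : Bs ∈ Set.range (List.map fun u : α => [u]) := by
      rw [Set.range_list_map]
      intro B hB
      obtain ⟨u, -, rfl⟩ := List.mem_map.1 (hm B hB)
      exact ⟨u, rfl⟩
    obtain ⟨R, rfl⟩ := hr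
    refine ⟨R, hn.of_map _, fun r hr => ?_, ?_⟩
    · simpa using hm [r] (List.mem_map.2 ⟨r, hr, rfl⟩)
    · rw [List.forall₂_map_left_iff] at hf
      exact hf.imp fun r C h => by simpa [meets] using h
  · rintro ⟨R, hn, hm, hf⟩
    refine ⟨R.map fun u => [u], hn.map fun a b h => by simpa using h, fun B hB => ?_, ?_⟩
    · obtain ⟨r, hr, rfl⟩ := List.mem_map.1 hB
      exact List.mem_map.2 ⟨r, hm r hr, rfl⟩
    · rw [List.forall₂_map_left_iff]
      exact hf.imp fun r C h => by simpa [meets] using h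

end Matching

/-! ### Correctness of the algorithm -/

/-- The differences between adjacent cells. -/
def directions : List (ℤ × ℤ) := [(1, 0), (-1, 0), (0, 1), (0, -1), (1, -1), (-1, 1)]

theorem adj_iff_sub_mem {c c' : Cell} : hexGrid.Adj c c' ↔ c' - c ∈ directions := by
  simp [hexGrid, directions, Prod.ext_iff]

/-- The offsets `e - f` are those between cells with a common neighbour, so geometry becomes a
finite check. -/
theorem length_filter_directions_le : ∀ e ∈ directions, ∀ f ∈ directions, e - f ≠ 0 →
    (directions.filter fun d => decide (d - (e - f) ∈ directions)).length ≤ 2 := by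
  decide

/-- Two different cells have at most two common neighbours. -/
theorem length_common_neighbors_le {a b : Cell} (hab : a ≠ b) {l : List Cell} (hl : l.Nodup)
    (h : ∀ u ∈ l, hexGrid.Adj a u ∧ hexGrid.Adj b u) : l.length ≤ 2 := by
  simp only [adj_iff_sub_mem] at h
  rcases l with _ | ⟨u, l⟩
  · simp
  have hu := h u (by simp)
  -- A single common neighbour writes `b - a` as a difference of two directions; translating by `a`
  -- then reduces the count to the finite check.
  have he : u - a - (u - b) = b - a := by abel
  have key := length_filter_directions_le _ hu.1 _ hu.2 (by
    rw [he]; exact sub_ne_zero.2 hab.symm)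
  rw [he] at key
  have hn : ((u :: l).map fun v => v - a).Nodup := hl.map fun _ _ h => sub_left_injective h
  have hs : ((u :: l).map fun v => v - a) ⊆
      directions.filter fun d => decide (d - (b - a) ∈ directions) := by
    intro d hd
    obtain ⟨v, hv, rfl⟩ := List.mem_map.1 hd
    have := h v hv
    refine List.mem_filter.2 ⟨this.1, decide_eq_true ?_⟩
    rw [show v - a - (b - a) = v - b by abel]
    exact this.2
  have := (hn.subperm hs).length_le
  rw [List.length_map] at this
  exact this.trans (by convert key)

/-! ### Well-formed data, solutions and representatives -/

/-- The properties that `wellFormed` checks. -/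
structure WellFormed (x : Data) : Prop where
  ne_nil : x.1 ≠ []
  nodup_cells : x.1.Nodup
  nodup_links : x.2.2.Nodup
  nodup_placed : (placedCells x).Nodup
  placed_mem : ∀ c ∈ placedCells x, c ∈ x.1
  odd_placed : ∀ i < x.2.1.length, ∃ e ∈ x.2.1, e.2 = 2 * i + 1
  length_free : (freeCells x).length = x.2.1.length ∨ (freeCells x).length + 1 = x.2.1.length
  link_adj : ∀ e ∈ x.2.2, e.1 ∈ x.1 ∧ e.2 ∈ x.1 ∧ hexGrid.Adj e.1 e.2

theorem wellFormed_iff (x : Data) : wellFormed x = true ↔ WellFormed x := by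
  simp only [wellFormed, Bool.and_eq_true, Bool.or_eq_true, Bool.not_eq_true', decide_eq_true_eq,
    List.all_eq_true, List.any_eq_true, List.mem_range, List.isEmpty_eq_false_iff, adjB_iff]
  exact ⟨fun ⟨h₁, h₂, h₃, h₄, h₅, h₆, h₇, h₈⟩ => ⟨h₁, h₂, h₃, h₄, h₅, h₆, h₇, h₈⟩,
    fun ⟨h₁, h₂, h₃, h₄, h₅, h₆, h₇, h₈⟩ => ⟨h₁, h₂, h₃, h₄, h₅, h₆, h₇, h₈⟩⟩

theorem mem_freeCells {x : Data} {c : Cell} :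
    c ∈ freeCells x ↔ c ∈ x.1 ∧ c ∉ placedCells x := by
  simp [freeCells]

theorem mem_placedCells {x : Data} {c : Cell} : c ∈ placedCells x ↔ ∃ v, (c, v) ∈ x.2.1 := by
  simp [placedCells]

theorem mem_slot {x : Data} {i : ℕ} {c : Cell} :
    c ∈ slot x i ↔ ∃ v, (c, v) ∈ x.2.1 ∧ (v = 2 * i + 1 ∨ v = 2 * i + 3) := by
  simp [slot, mul_add]

theorem mem_candidates {x : Data} {i : ℕ} {u : Cell} : u ∈ candidates x i ↔
    u ∈ freeCells x ∧ (∀ c ∈ slot x i, hexGrid.Adj c u) ∧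
      ∀ e ∈ x.2.2, (e.1 = u → e.2 ∈ slot x i) ∧ (e.2 = u → e.1 ∈ slot x i) := by
  simp only [candidates, List.mem_filter, Bool.and_eq_true, List.all_eq_true, adjB_iff,
    Bool.or_eq_true, Bool.not_eq_true', decide_eq_true_eq, decide_eq_false_iff_not,
    ← imp_iff_not_or]

theorem length_cells {x : Data} (hc : x.1.Nodup) (hp : (placedCells x).Nodup)
    (hm : ∀ c ∈ placedCells x, c ∈ x.1) :
    x.1.length = (freeCells x).length + x.2.1.length := by
  have h₁ : (x.1.filter fun c => decide (c ∈ placedCells x)).Perm (placedCells x) := by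
    refine (List.perm_ext_iff_of_nodup (hc.filter _) hp).2 fun c => ?_
    simp only [List.mem_filter, decide_eq_true_eq]
    exact ⟨fun h => h.2, fun h => ⟨hm c h, h⟩⟩
  have h₂ := h₁.length_eq
  have h₃ := List.length_eq_length_filter_add (l := x.1) fun c => decide (c ∈ placedCells x)
  rw [placedCells, List.length_map] at h₂
  rw [freeCells]
  unfold placedCells at *
  omega

/-- `s` is a solution of the game described by `x`. -/
structure Solves (x : Data) (s : Cell → ℕ) : Prop where
  bij : Set.BijOn s {c | c ∈ x.1} (Set.Icc 1 x.1.length)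
  path : ∀ c ∈ x.1, ∀ c' ∈ x.1, |(s c : ℤ) - (s c' : ℤ)| = 1 → hexGrid.Adj c c'
  placed : ∀ c v, (c, v) ∈ x.2.1 → s c = v
  given : ∀ c c', (c, c') ∈ x.2.2 → |(s c : ℤ) - (s c' : ℤ)| = 1

theorem abs_sub_eq_one {a b : ℕ} : |(a : ℤ) - (b : ℤ)| = 1 ↔ a = b + 1 ∨ b = a + 1 := by
  rw [abs_eq (by norm_num)]
  omega

namespace WellFormed

variable {x : Data}

theorem length_eq (h : WellFormed x) : x.1.length = (freeCells x).length + x.2.1.length :=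
  length_cells h.nodup_cells h.nodup_placed h.placed_mem

/-- Pigeonhole: with k placed entries, the k smallest odd numbers all occur among the k values, so
there is no other value and no repetition. -/
theorem value_perm (h : WellFormed x) :
    ((List.range x.2.1.length).map fun i => 2 * i + 1).Perm (x.2.1.map fun e => e.2) := by
  have hn : ((List.range x.2.1.length).map fun i => 2 * i + 1).Nodup :=
    List.nodup_range.map fun i j (h : 2 * i + 1 = 2 * j + 1) => by omega
  refine (hn.subperm fun v hv => ?_).perm_of_length_le (by simp)
  obtain ⟨i, hi, rfl⟩ := List.mem_map.1 hv
  obtain ⟨e, he, hv⟩ := h.odd_placed i (List.mem_range.1 hi)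
  exact List.mem_map.2 ⟨e, he, hv⟩

theorem value_odd (h : WellFormed x) {c : Cell} {v : ℕ} (hv : (c, v) ∈ x.2.1) :
    ∃ i < x.2.1.length, v = 2 * i + 1 := by
  have := h.value_perm.mem_iff.2 (List.mem_map.2 ⟨_, hv, rfl⟩)
  obtain ⟨i, hi, hv⟩ := List.mem_map.1 this
  exact ⟨i, List.mem_range.1 hi, hv.symm⟩

theorem value_inj (h : WellFormed x) {c c' : Cell} {v : ℕ} (hv : (c, v) ∈ x.2.1)
    (hv' : (c', v) ∈ x.2.1) : c = c' := by
  have hn : (x.2.1.map fun e => e.2).Nodup :=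
    h.value_perm.nodup_iff.1 (List.nodup_range.map fun i j (h : 2 * i + 1 = 2 * j + 1) => by omega)
  exact congrArg Prod.fst (List.inj_on_of_nodup_map hn hv hv' rfl)

theorem value_unique (h : WellFormed x) {c : Cell} {v v' : ℕ} (hv : (c, v) ∈ x.2.1)
    (hv' : (c, v') ∈ x.2.1) : v = v' :=
  congrArg Prod.snd (List.inj_on_of_nodup_map h.nodup_placed hv hv' rfl)

/-- The bound on `i` guarantees that 2i+3 is placed as well, so a candidate is a common neighbour of
two distinct cells. -/
theorem length_candidates_le (h : WellFormed x) {i : ℕ} (hi : i + 1 < (freeCells x).length) :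
    (candidates x i).length ≤ 2 := by
  have hlen := h.length_free
  obtain ⟨⟨a, v⟩, ha, hv⟩ := h.odd_placed i (by omega)
  obtain ⟨⟨b, w⟩, hb, hw⟩ := h.odd_placed (i + 1) (by omega)
  simp only at hv hw
  subst hv hw
  have hab : a ≠ b := by
    rintro rfl
    have := h.value_unique ha hb
    omega
  refine length_common_neighbors_le hab ((h.nodup_cells.filter _).filter _) fun u hu => ?_
  have hu := (mem_candidates.1 hu).2.1
  exact ⟨hu a (mem_slot.2 ⟨_, ha, .inl rfl⟩), hu b (mem_slot.2 ⟨_, hb, .inr rfl⟩)⟩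

theorem exists_representatives_of_solves (h : WellFormed x) {s : Cell → ℕ} (hs : Solves x s) :
    (∀ e ∈ x.2.2, ¬(e.1 ∈ placedCells x ∧ e.2 ∈ placedCells x)) ∧
      ∃ R : List Cell, R.Nodup ∧ (∀ r ∈ R, r ∈ freeCells x) ∧ List.Forall₂ (· ∈ ·) R
        ((List.range (freeCells x).length).map (candidates x)) := by
  have hlen := h.length_eq
  have hfree := h.length_free
  have hodd : ∀ c ∈ placedCells x, ∃ i, s c = 2 * i + 1 := by
    intro c hc
    obtain ⟨v, hv⟩ := mem_placedCells.1 hc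
    obtain ⟨i, -, rfl⟩ := h.value_odd hv
    exact ⟨i, hs.placed _ _ hv⟩
  have hplaced : ∀ c ∈ x.1, ∀ i, s c = 2 * i + 1 → (c, 2 * i + 1) ∈ x.2.1 := by
    intro c hc i hi
    have hle := (hs.bij.mapsTo hc).2
    obtain ⟨⟨c', v⟩, he, hv⟩ := h.odd_placed i (by omega)
    simp only at hv
    subst hv
    have hc' : c' ∈ x.1 := h.placed_mem c' (mem_placedCells.2 ⟨_, he⟩)
    have : c = c' := hs.bij.injOn hc hc' (by rw [hi, hs.placed _ _ he])
    rwa [this]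
  refine ⟨fun e he ⟨h₁, h₂⟩ => ?_, ?_⟩
  · obtain ⟨i, hi⟩ := hodd _ h₁
    obtain ⟨j, hj⟩ := hodd _ h₂
    have := abs_sub_eq_one.1 (hs.given e.1 e.2 he)
    omega
  -- The representative of slot `i` is the cell that carries 2i+2; beyond the range its value is
  -- arbitrary.
  have hg : ∀ i, ∃ c, i < (freeCells x).length → c ∈ x.1 ∧ s c = 2 * i + 2 := by
    intro i
    by_cases hi : i < (freeCells x).length
    · obtain ⟨c, hc, hv⟩ := hs.bij.surjOn (show 2 * i + 2 ∈ Set.Icc 1 x.1.length from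
        ⟨by omega, by omega⟩)
      exact ⟨c, fun _ => ⟨hc, hv⟩⟩
    · exact ⟨(0, 0), fun h => absurd h hi⟩
  choose g hg using hg
  have hgU : ∀ i < (freeCells x).length, g i ∈ freeCells x := by
    intro i hi
    refine mem_freeCells.2 ⟨(hg i hi).1, fun hp => ?_⟩
    obtain ⟨j, hj⟩ := hodd _ hp
    have := (hg i hi).2
    omega
  refine ⟨(List.range (freeCells x).length).map g, ?_, ?_, ?_⟩
  · refine List.nodup_range.map_on fun i hi j hj hij => ?_
    have h₁ := (hg i (List.mem_range.1 hi)).2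
    have h₂ := (hg j (List.mem_range.1 hj)).2
    rw [hij] at h₁
    omega
  · intro r hr
    obtain ⟨i, hi, rfl⟩ := List.mem_map.1 hr
    exact hgU i (List.mem_range.1 hi)
  · rw [List.forall₂_map_left_iff, List.forall₂_map_right_iff, List.forall₂_same]
    intro i hi
    have hi := List.mem_range.1 hi
    obtain ⟨hgc, hgi⟩ := hg i hi
    have hslot : ∀ c ∈ x.1, |(s (g i) : ℤ) - (s c : ℤ)| = 1 → c ∈ slot x i := by
      intro c hc hd
      rcases abs_sub_eq_one.1 hd with hd | hd
      · exact mem_slot.2 ⟨_, hplaced c hc i (by omega), .inl rfl⟩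
      · exact mem_slot.2 ⟨_, hplaced c hc (i + 1) (by omega), .inr (by ring)⟩
    refine mem_candidates.2 ⟨hgU i hi, fun c hc => ?_, fun e he => ⟨?_, ?_⟩⟩
    · obtain ⟨v, hv, hvi⟩ := mem_slot.1 hc
      refine hs.path c (h.placed_mem c (mem_placedCells.2 ⟨_, hv⟩)) _ hgc (abs_sub_eq_one.2 ?_)
      rw [hs.placed c v hv, hgi]
      omega
    · intro hu
      exact hslot _ (h.link_adj e he).2.1 (hu ▸ hs.given e.1 e.2 he)
    · intro hu
      exact hslot _ (h.link_adj e he).1 (by rw [abs_sub_comm]; exact hu ▸ hs.given e.1 e.2 he)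

-- The representative with index i receives 2i+2. A link between two free cells cannot occur here:
-- slots contain placed cells only, so `candidates` would have rejected its ends.
open scoped Classical in
theorem exists_solves_of_representatives (h : WellFormed x)
    (hlink : ∀ e ∈ x.2.2, ¬(e.1 ∈ placedCells x ∧ e.2 ∈ placedCells x)) {R : List Cell}
    (hR : R.Nodup) (hRU : ∀ r ∈ R, r ∈ freeCells x) (hRC : List.Forall₂ (· ∈ ·) R
      ((List.range (freeCells x).length).map (candidates x))) : ∃ s, Solves x s := by
  have hlen := h.length_eq
  have hfree := h.length_free
  have hRlen : R.length = (freeCells x).length := by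
    simpa using hRC.length_eq
  have hUR : ∀ c ∈ freeCells x, ∃ i, ∃ hi : i < R.length, R[i] = c := by
    intro c hc
    have hp : R.Perm (freeCells x) := (hR.subperm hRU).perm_of_length_le hRlen.ge
    exact List.mem_iff_getElem.1 (hp.mem_iff.2 hc)
  have hcand : ∀ i, ∀ hi : i < R.length, R[i] ∈ candidates x i := by
    intro i hi
    have := hRC.get hi (by simpa [← hRlen] using hi)
    simpa using this
  let s : Cell → ℕ := fun c =>
    if hc : ∃ v, (c, v) ∈ x.2.1 then hc.choose else 2 * R.idxOf c + 2
  have hsp : ∀ c v, (c, v) ∈ x.2.1 → s c = v := by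
    intro c v hv
    have hc : ∃ v, (c, v) ∈ x.2.1 := ⟨v, hv⟩
    simp only [s, dif_pos hc]
    exact h.value_unique hc.choose_spec hv
  have hsR : ∀ i, ∀ hi : i < R.length, s R[i] = 2 * i + 2 := by
    intro i hi
    have hc : ¬∃ v, (R[i], v) ∈ x.2.1 := fun hc =>
      (mem_freeCells.1 (hRU _ (List.getElem_mem hi))).2 (mem_placedCells.2 hc)
    simp only [s, dif_neg hc]
    rw [hR.idxOf_getElem]
  have hcases : ∀ c ∈ x.1, (∃ i, i < x.2.1.length ∧ (c, 2 * i + 1) ∈ x.2.1 ∧ s c = 2 * i + 1) ∨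
      ∃ i, ∃ hi : i < R.length, R[i] = c ∧ s c = 2 * i + 2 := by
    intro c hc
    by_cases hp : c ∈ placedCells x
    · obtain ⟨v, hv⟩ := mem_placedCells.1 hp
      obtain ⟨i, hi, rfl⟩ := h.value_odd hv
      exact .inl ⟨i, hi, hv, hsp _ _ hv⟩
    · obtain ⟨i, hi, rfl⟩ := hUR c (mem_freeCells.2 ⟨hc, hp⟩)
      exact .inr ⟨i, hi, rfl, hsR i hi⟩
  have hadj : ∀ i, ∀ hi : i < R.length, ∀ c ∈ x.1, (s c = 2 * i + 1 ∨ s c = 2 * i + 3) →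
      hexGrid.Adj c R[i] := by
    intro i hi c hc hsc
    rcases hcases c hc with ⟨j, -, hj, hsj⟩ | ⟨j, -, -, hsj⟩
    · exact (mem_candidates.1 (hcand i hi)).2.1 c (mem_slot.2 ⟨_, hj, by omega⟩)
    · omega
  have hgiven : ∀ i, ∀ hi : i < R.length, ∀ c ∈ slot x i,
      |(s R[i] : ℤ) - (s c : ℤ)| = 1 := by
    intro i hi c hc
    obtain ⟨v, hv, hvi⟩ := mem_slot.1 hc
    rw [abs_sub_eq_one, hsR i hi, hsp c v hv]
    omega
  refine ⟨s, ⟨fun c hc => ?_, fun c hc c' hc' hcc => ?_, fun v hv => ?_⟩,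
    fun c hc c' hc' hd => ?_, hsp, fun c c' he => ?_⟩
  · rcases hcases c hc with ⟨i, hi, -, hsc⟩ | ⟨i, hi, -, hsc⟩ <;>
    · rw [Set.mem_Icc, hsc]; omega
  · rcases hcases c hc with ⟨i, -, hi, hsc⟩ | ⟨i, hi, rfl, hsc⟩ <;>
      rcases hcases c' hc' with ⟨j, -, hj, hsc'⟩ | ⟨j, hj, rfl, hsc'⟩
    · obtain rfl : i = j := by omega
      exact h.value_inj hi hj
    · omega
    · omega
    · obtain rfl : i = j := by omega
      rfl
  · rw [Set.mem_Icc] at hv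
    rcases Nat.even_or_odd' v with ⟨i, rfl | rfl⟩
    · obtain ⟨i, rfl⟩ : ∃ j, i = j + 1 := ⟨i - 1, by omega⟩
      have hi : i < R.length := by omega
      exact ⟨R[i], (mem_freeCells.1 (hRU _ (List.getElem_mem hi))).1, hsR i hi⟩
    · obtain ⟨⟨c, w⟩, he, hw⟩ := h.odd_placed i (by omega)
      simp only at hw
      subst hw
      exact ⟨c, h.placed_mem c (mem_placedCells.2 ⟨_, he⟩), hsp _ _ he⟩
  · rw [abs_sub_eq_one] at hd
    rcases hcases c hc with ⟨i, -, -, hsc⟩ | ⟨i, hi, rfl, hsc⟩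
    · rcases hcases c' hc' with ⟨j, -, -, hsc'⟩ | ⟨j, hj, rfl, hsc'⟩
      · omega
      · exact hadj j hj c hc (by omega)
    · exact (hadj i hi c' hc' (by omega)).symm
  · obtain ⟨hc, hc', -⟩ := h.link_adj _ he
    simp only at hc hc'
    by_cases hp : c ∈ placedCells x
    · have hp' : c' ∉ placedCells x := fun hp' => hlink _ he ⟨hp, hp'⟩
      obtain ⟨i, hi, rfl⟩ := hUR c' (mem_freeCells.2 ⟨hc', hp'⟩)
      rw [abs_sub_comm]
      exact hgiven i hi c (((mem_candidates.1 (hcand i hi)).2.2 _ he).2 rfl)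
    · obtain ⟨i, hi, rfl⟩ := hUR c (mem_freeCells.2 ⟨hc, hp⟩)
      exact hgiven i hi c' (((mem_candidates.1 (hcand i hi)).2.2 _ he).1 rfl)

theorem check_iff (h : WellFormed x) : check x = true ↔ ∃ s, Solves x s := by
  have hC : ∀ C ∈ ((List.range (freeCells x).length).map (candidates x)).dropLast,
      C.length ≤ 2 := by
    intro C hC
    rw [← List.map_dropLast] at hC
    obtain ⟨i, hi, rfl⟩ := List.mem_map.1 hC
    obtain ⟨j, hj, rfl⟩ := List.mem_iff_getElem.1 hi
    rw [List.length_dropLast, List.length_range] at hj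
    rw [List.getElem_dropLast, List.getElem_range]
    exact h.length_candidates_le (by omega)
  rw [check, Bool.and_eq_true, Bool.and_eq_true, wellFormed_iff,
    hasMatching_iff (U := freeCells x) (h.nodup_cells.filter _) hC]
  simp only [h, true_and, List.all_eq_true, Bool.not_eq_true', Bool.and_eq_false_iff,
    decide_eq_false_iff_not, ← not_and_or]
  exact ⟨fun ⟨h₁, R, h₂, h₃, h₄⟩ => h.exists_solves_of_representatives h₁ h₂ h₃ h₄,
    fun ⟨s, hs⟩ => h.exists_representatives_of_solves hs⟩

end WellFormed

/-! ### From data to games -/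

/-- The lists of `x` are those of the game `G`. -/
def Describes (x : Data) (G : Game) : Prop :=
  x.1.Nodup ∧ x.2.1.Nodup ∧ x.2.2.Nodup ∧ (∀ c, c ∈ x.1 ↔ c ∈ G.τ) ∧
    (∀ c v, (c, v) ∈ x.2.1 ↔ G.m c = some v) ∧ ∀ e, e ∈ x.2.2 ↔ e ∈ G.p

namespace Describes

variable {x : Data} {G : Game}

theorem length_eq (h : Describes x G) : x.1.length = G.n := by
  have : G.τ = x.1.toFinset := by
    ext c
    rw [List.mem_toFinset, h.2.2.2.1]
  rw [Game.n, this, List.toFinset_card_of_nodup h.1]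

theorem isSolution_iff (h : Describes x G) (s : Cell → ℕ) : G.IsSolution s ↔ Solves x s := by
  have hτ : (G.τ : Set Cell) = {c | c ∈ x.1} := by
    ext c
    exact (h.2.2.2.1 c).symm
  have hn := h.length_eq
  obtain ⟨-, -, -, hc, hm, hp⟩ := h
  constructor
  · rintro ⟨h₁, h₂, h₃, h₄⟩
    exact ⟨by rwa [← hτ, hn], fun c hc₁ c' hc₂ => h₂ c ((hc c).1 hc₁) c' ((hc c').1 hc₂),
      fun c v hv => h₃ c v ((hm c v).1 hv), fun c c' he => h₄ c c' ((hp _).1 he)⟩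
  · rintro ⟨h₁, h₂, h₃, h₄⟩
    exact ⟨by rwa [hτ, ← hn], fun c hc₁ c' hc₂ => h₂ c ((hc c).2 hc₁) c' ((hc c').2 hc₂),
      fun c v hv => h₃ c v ((hm c v).2 hv), fun c c' he => h₄ c c' ((hp _).2 he)⟩

theorem wellFormed (h : Describes x G) (hG : G.IsOneOver 2) : WellFormed x := by
  have hn := h.length_eq
  obtain ⟨hc, hm, hl, hτ, hmG, hp⟩ := h
  have hodd : ∀ v, (∃ c, (c, v) ∈ x.2.1) ↔ (∃ i, v = 2 * i + 1) ∧ v ≤ x.1.length := by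
    intro v
    have := Set.ext_iff.1 hG v
    simp only [Set.mem_ofPred_eq, Set.mem_inter_iff, Set.mem_Icc, ← hmG, ← hn] at this
    rw [this]
    constructor
    · rintro ⟨⟨i, hi⟩, -, hv⟩
      exact ⟨⟨i, by omega⟩, hv⟩
    · rintro ⟨⟨i, hi⟩, hv⟩
      exact ⟨⟨i, by omega⟩, by omega, hv⟩
  have hnp : (placedCells x).Nodup := by
    refine hm.map_on fun e he e' he' hee => ?_
    have h₁ := (hmG e.1 e.2).1 he
    have h₂ := (hmG e'.1 e'.2).1 he'
    rw [hee, h₂] at h₁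
    exact Prod.ext hee (Option.some.inj h₁).symm
  have hnv : (x.2.1.map fun e => e.2).Nodup := by
    refine hm.map_on fun e he e' he' hee => ?_
    have h₁ := (hmG e.1 e.2).1 he
    have h₂ := (hmG e'.1 e'.2).1 he'
    exact Prod.ext (G.m_inj _ _ _ h₁ (hee ▸ h₂)) hee
  -- The odd numbers up to n are half of all, rounded up, which gives the two alternatives for the
  -- number of free cells.
  have hperm : (x.2.1.map fun e => e.2).Perm
      ((List.range ((x.1.length + 1) / 2)).map fun i => 2 * i + 1) := by
    refine (List.perm_ext_iff_of_nodup hnv (List.nodup_range.map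
      fun i j (h : 2 * i + 1 = 2 * j + 1) => by omega)).2 fun v => ?_
    have h₁ : (∃ e ∈ x.2.1, e.2 = v) ↔ ∃ c, (c, v) ∈ x.2.1 :=
      ⟨fun ⟨e, he, hv⟩ => ⟨e.1, hv ▸ he⟩, fun ⟨c, hc⟩ => ⟨_, hc, rfl⟩⟩
    simp only [List.mem_map, List.mem_range]
    rw [h₁, hodd]
    constructor
    · rintro ⟨⟨i, rfl⟩, hi⟩
      exact ⟨i, by omega, rfl⟩
    · rintro ⟨i, hi, rfl⟩
      exact ⟨⟨i, rfl⟩, by omega⟩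
  have hlen : x.2.1.length = (x.1.length + 1) / 2 := by
    simpa using hperm.length_eq
  have hpm : ∀ c ∈ placedCells x, c ∈ x.1 := by
    intro c hc
    obtain ⟨v, hv⟩ := mem_placedCells.1 hc
    exact (hτ c).2 (G.m_dom c v ((hmG c v).1 hv))
  have hlen' := length_cells hc hnp hpm
  refine ⟨?_, hc, hl, hnp, hpm, fun i hi => ?_, by omega, fun e he => ?_⟩
  · intro h
    obtain ⟨c, hcτ⟩ := G.connected.nonempty
    have := (hτ c).2 hcτ
    simp [h] at this
  · obtain ⟨c, hv⟩ := (hodd (2 * i + 1)).2 ⟨⟨i, rfl⟩, by omega⟩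
    exact ⟨_, hv, rfl⟩
  · have := G.p_adj e.1 e.2 ((hp e).1 he)
    exact ⟨(hτ _).2 this.1, (hτ _).2 this.2.1, this.2.2⟩

end Describes

/-- Following the numbers from 1 upwards is a path through all cells, so connectedness follows from
solvability. -/
theorem Solves.connected {x : Data} {s : Cell → ℕ} (hs : Solves x s) (hx : x.1 ≠ []) :
    (hexGrid.induce {c | c ∈ x.1}).Connected := by
  have hpos : 0 < x.1.length := List.length_pos_iff.2 hx
  obtain ⟨c₁, hc₁, hs₁⟩ := hs.bij.surjOn (show 1 ∈ Set.Icc 1 x.1.length from ⟨le_rfl, hpos⟩)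
  have key : ∀ v, ∀ c : {c | c ∈ x.1}, s c = v + 1 →
      (hexGrid.induce {c | c ∈ x.1}).Reachable ⟨c₁, hc₁⟩ c := by
    intro v
    induction v with
    | zero =>
      intro c hc
      have : (⟨c₁, hc₁⟩ : {c | c ∈ x.1}) = c :=
        Subtype.ext (hs.bij.injOn hc₁ c.2 (by rw [hs₁, hc]))
      rw [this]
    | succ v ih =>
      intro c hc
      have hle := (hs.bij.mapsTo c.2).2
      obtain ⟨c', hc', hs'⟩ := hs.bij.surjOn (show v + 1 ∈ Set.Icc 1 x.1.length from
        ⟨by omega, by omega⟩)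
      refine (ih ⟨c', hc'⟩ hs').trans (SimpleGraph.Adj.reachable ?_)
      exact hs.path c' hc' c c.2 (abs_sub_eq_one.2 (by omega))
  have : Nonempty {c | c ∈ x.1} := ⟨⟨c₁, hc₁⟩⟩
  refine ⟨fun c c' => ?_⟩
  have h₁ := (hs.bij.mapsTo c.2).1
  have h₂ := (hs.bij.mapsTo c'.2).1
  exact (key (s c - 1) c (by omega)).symm.trans (key (s c' - 1) c' (by omega))

-- With k placed and k or k - 1 free cells, n is 2k or 2k - 1, so the k smallest odd numbers are
-- exactly those up to n.
open scoped Classical in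
theorem WellFormed.exists_game {x : Data} (h : WellFormed x)
    (hc : (hexGrid.induce {c | c ∈ x.1}).Connected) :
    ∃ G : Game, Describes x G ∧ G.IsOneOver 2 := by
  have hm : ∀ c v, (if hc : ∃ v, (c, v) ∈ x.2.1 then some hc.choose else none) = some v ↔
      (c, v) ∈ x.2.1 := by
    intro c v
    by_cases hc : ∃ v, (c, v) ∈ x.2.1
    · rw [dif_pos hc, Option.some.injEq]
      exact ⟨fun e => e ▸ hc.choose_spec, fun hv => h.value_unique hc.choose_spec hv⟩
    · rw [dif_neg hc]
      exact ⟨fun e => by simp at e, fun hv => absurd ⟨v, hv⟩ hc⟩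
  have hcard : x.1.toFinset.card = x.1.length := List.toFinset_card_of_nodup h.nodup_cells
  have hlen := h.length_eq
  have hfree := h.length_free
  let G : Game :=
    { τ := x.1.toFinset
      connected := by
        convert hc using 2 <;> ext c <;> simp
      m := fun c => if hc : ∃ v, (c, v) ∈ x.2.1 then some hc.choose else none
      m_dom := fun c v hv => List.mem_toFinset.2
        (h.placed_mem c (mem_placedCells.2 ⟨v, (hm c v).1 hv⟩))
      m_range := fun c v hv => by
        obtain ⟨i, hi, rfl⟩ := h.value_odd ((hm c v).1 hv)
        rw [hcard]
        omega
      m_inj := fun c c' v hv hv' => h.value_inj ((hm c v).1 hv) ((hm c' v).1 hv')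
      p := x.2.2.toFinset
      p_adj := fun c c' he => by
        have := h.link_adj _ (List.mem_toFinset.1 he)
        exact ⟨List.mem_toFinset.2 this.1, List.mem_toFinset.2 this.2.1, this.2.2⟩ }
  refine ⟨G, ⟨h.nodup_cells, h.nodup_placed.of_map _, h.nodup_links,
    fun c => List.mem_toFinset.symm, fun c v => (hm c v).symm, fun e => List.mem_toFinset.symm⟩, ?_⟩
  ext v
  simp only [Set.mem_ofPred_eq, Set.mem_inter_iff, Set.mem_Icc]
  have hGn : G.n = x.1.length := hcard
  rw [hGn]
  constructor
  · rintro ⟨c, hv⟩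
    obtain ⟨i, hi, rfl⟩ := h.value_odd ((hm c v).1 hv)
    exact ⟨⟨i, by ring⟩, by omega, by omega⟩
  · rintro ⟨⟨i, rfl⟩, -, hv⟩
    obtain ⟨⟨c, w⟩, he, hw⟩ := h.odd_placed i (by omega)
    simp only at hw
    subst hw
    exact ⟨c, (hm _ _).2 (by rwa [mul_comm i 2])⟩

theorem check_iff (x : Data) :
    check x = true ↔ ∃ G : Game, Describes x G ∧ G.IsOneOver 2 ∧ G.Solvable := by
  constructor
  · intro hx
    have h : WellFormed x := (wellFormed_iff x).1 (by
      rw [check, Bool.and_eq_true] at hx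
      exact hx.1)
    obtain ⟨s, hs⟩ := h.check_iff.1 hx
    obtain ⟨G, hG, hG'⟩ := h.exists_game (hs.connected h.ne_nil)
    exact ⟨G, hG, hG', s, (hG.isSolution_iff s).2 hs⟩
  · rintro ⟨G, hG, hG', s, hs⟩
    exact (hG.wellFormed hG').check_iff.2 ⟨s, (hG.isSolution_iff s).1 hs⟩

/-- If the comparison succeeds, the parsed lists witness that `w` is an encoding; conversely an
encoding is parsed back to its own lists. -/
theorem decideWord_iff (w : List Γ') : decideWord w = true ↔ w ∈ oneOverRikudo 2 := by
  have hL : w ∈ oneOverRikudo 2 ↔ ∃ G : Game, Encodes w G ∧ G.IsOneOver 2 ∧ G.Solvable := Iff.rfl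
  rw [hL, decideWord, Bool.and_eq_true, decide_eq_true_eq, check_iff]
  constructor
  · rintro ⟨hw, G, ⟨h₁, h₂, h₃, h₄, h₅, h₆⟩, hG⟩
    exact ⟨G, ⟨_, _, _, h₁, h₂, h₃, h₄, h₅, h₆, hw.symm⟩, hG⟩
  · rintro ⟨G, ⟨cells, placed, links, h₁, h₂, h₃, h₄, h₅, h₆, rfl⟩, hG⟩
    rw [parse_encLists (cells, placed, links)]
    exact ⟨rfl, G, ⟨h₁, h₂, h₃, h₄, h₅, h₆⟩, hG⟩

end Rikudo

theorem theorem3 : Rikudo.InP (Rikudo.oneOverRikudo 2) :=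
  Rikudo.PolyTime.decideWord.inP Rikudo.decideWord_iff
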